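/- Let $\mathfrak{gl}(1|1)$ be the complex Lie superalgebra with basis $e_{ij}$, $i,j\in\{1,2\}$, of parity $|i|+|j|$, where $|1|=\bar 0$, $|2|=\bar 1$, and let $\mathfrak{gl}(1|1)[t]=\mathfrak{gl}(1|1)\otimes\mathbb C[t]$ be its current superalgebra, with basis $e_{ij}[r]=e_{ij}\otimes t^r$, $r\ge 0$, and supercommutators $$[e_{ij}[r],e_{kl}[s]]=\delta_{jk}e_{il}[r+s]-(-1)^{(|i|+|j|)(|k|+|l|)}\delta_{il}e_{kj}[r+s].$$ Put $e_{ij}(x)=\sum_{r\ge 0}e_{ij}[r]x^{-r-1}$. The Gaudin transfer matrix is the series $$\mathscr H(x)=\sum_{r\ge 2}\mathscr H_r x^{-r}=\frac12\sum_{a,b=1}^2(-1)^{|b|}e_{ab}(x)e_{ba}(x)$$ with coefficients in $\mathrm U(\mathfrak{gl}(1|1)[t])$. For $m\ge 0$ and $b\in\mathbb C$ let $W_m(b)$ be the Weyl module: the $\mathfrak{gl}(1|1)[t]$-module generated by an even vector $w$ subject to the relations $$e_{11}(x)w=\frac{m}{x-b}\,w,\qquad e_{22}(x)w=e_{12}(x)w=0,\qquad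 (e_{21}\otimes(t-b)^m)\,w=0 .$$ For a $\mathfrak{gl}(1|1)[t]$-module $M$ let $M^{\mathrm{sing}}=\{v\in M: e_{12}[0]v=0\}$. A nonzero $v\in M$ is an eigenvector of $\mathscr H(x)$ with eigenvalue $\xi(x)=\sum_{r\ge2}\xi_rx^{-r}$, $\xi_r\in\mathbb C$, if $\mathscr H_rv=\xi_rv$ for all $r\ge2$; rational functions of $x$ are expanded as series in $x^{-1}$. Let $\boldsymbol b=(b_1,\dots,b_k)$ be a sequence of distinct complex numbers and $\boldsymbol n=(n_1,\dots,n_k)$ a sequence of nonnegative integers, not all zero. Consider the (super) tensor product $\bigotimes_{s=1}^kW_{n_s}(b_s)$, and set $$\zeta(x)=\sum_{s=1}^k\frac{n_s}{x-b_s},\qquad \psi(x)=\zeta(x)\prod_{r=1}^k(x-b_r)^{n_r}\in\mathbb C[x].$$ Then $\mathscr H(x)$ has simple spectrum in $\big(\bigotimes_{s=1}^kW_{n_s}(b_s)\big)^{\mathrm{sing}}$: two eigenvectors of $\mathscr H(x)$ in this space that are not proportional have different eigenvalues. Moreover, there is a bijection $y\mapsto v_y$ between the monic divisors $y$ of the polynomial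 $\psi$ and the eigenvectors of $\mathscr H(x)$ in $\big(\bigotimes_{s=1}^kW_{n_s}(b_s)\big)^{\mathrm{sing}}$, considered up to multiplication by a nonzero constant, such that $$\mathscr H(x)v_y=\Big(\frac12\zeta'(x)-\zeta(x)\frac{y'(x)}{y(x)}+\frac12\zeta(x)^2\Big)v_y .$$ -/

import Mathlib

open Polynomial
open scoped TensorProduct LaurentSeries LinearAlgebra.Projectivization

noncomputable section

namespace GL11

/-! Indices `1, 2` of the mathematics are `0, 1 : Fin 2`, so that the parity `|i|` of the basis
vector `v_i` of `ℂ^{1|1}` is the value of `i` itself. -/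

/-- The parity `|i| + |j|` of `e_{ij}[r]` (only its class modulo 2 matters). -/
def par (i j : Fin 2) : ℕ := i.val + j.val

/-! ### The enveloping superalgebra of the current superalgebra -/

/-- The free associative algebra on the basis `e_{ij}[r]` of `gl(1|1)[t]`. -/
abbrev Free : Type := FreeAlgebra ℂ (Fin 2 × Fin 2 × ℕ)

/-- The generator `e_{ij}[r]` of the free algebra. -/
def gen (i j : Fin 2) (r : ℕ) : Free := FreeAlgebra.ι ℂ (i, j, r)

/-- The supercommutator relations
`[e_{ij}[r], e_{kl}[s]] = δ_{jk} e_{il}[r+s] - (-1)^{(|i|+|j|)(|k|+|l|)} δ_{il} e_{kj}[r+s]`. -/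
inductive Rel : Free → Free → Prop
  | bracket (i j k l : Fin 2) (r s : ℕ) :
      Rel (gen i j r * gen k l s - (-1 : ℂ) ^ (par i j * par k l) • (gen k l s * gen i j r))
        ((if j = k then gen i l (r + s) else 0)
          - (-1 : ℂ) ^ (par i j * par k l) • (if i = l then gen k j (r + s) else 0))

/-- The universal enveloping superalgebra `U(gl(1|1)[t])`, as an associative algebra. -/
def U : Type := RingQuot Rel

instance : Ring U := inferInstanceAs (Ring (RingQuot Rel))

instance : Algebra ℂ U := inferInstanceAs (Algebra ℂ (RingQuot Rel))

/-- The projection from the free algebra onto `U(gl(1|1)[t])`. -/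
def toU : Free →ₐ[ℂ] U := RingQuot.mkAlgHom ℂ Rel

theorem toU_rel {x y : Free} (h : Rel x y) : toU x = toU y := RingQuot.mkAlgHom_rel ℂ h

/-- The universal property of the quotient. -/
def liftU {A : Type*} [Ring A] [Algebra ℂ A] (f : Free →ₐ[ℂ] A)
    (hf : ∀ x y, Rel x y → f x = f y) : U →ₐ[ℂ] A :=
  RingQuot.liftAlgHom ℂ ⟨f, fun x y h => hf x y h⟩

theorem liftU_toU {A : Type*} [Ring A] [Algebra ℂ A] (f : Free →ₐ[ℂ] A)
    (hf : ∀ x y, Rel x y → f x = f y) (x : Free) : liftU f hf (toU x) = f x :=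
  RingQuot.liftAlgHom_mkAlgHom_apply ℂ f (fun x y h => hf x y h) x

theorem U_hom_ext {A : Type*} [Ring A] [Algebra ℂ A] {f g : U →ₐ[ℂ] A}
    (h : f.comp toU = g.comp toU) : f = g :=
  RingQuot.ringQuot_ext' ℂ f g h

/-- The element `e_{ij}[r] = e_{ij} ⊗ t^r` of `U(gl(1|1)[t])`. -/
def uE (i j : Fin 2) (r : ℕ) : U := toU (gen i j r)

theorem uE_bracket (i j k l : Fin 2) (r s : ℕ) :
    uE i j r * uE k l s - (-1 : ℂ) ^ (par i j * par k l) • (uE k l s * uE i j r)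
      = (if j = k then uE i l (r + s) else 0)
        - (-1 : ℂ) ^ (par i j * par k l) • (if i = l then uE k j (r + s) else 0) := by
  have h := toU_rel (Rel.bracket i j k l r s)
  simp only [map_sub, map_mul, map_smul, apply_ite toU, map_zero] at h
  exact h

theorem sign_cancel (i j l : Fin 2) :
    (-1 : ℂ) ^ (par i j) * (-1 : ℂ) ^ (par j l) = (-1 : ℂ) ^ (par i l) := by
  fin_cases i <;> fin_cases j <;> fin_cases l <;> norm_num [par]

theorem par_comm (i j : Fin 2) : par i j = par j i := Nat.add_comm _ _

theorem bracket_rhs_smul {A : Type*} [AddCommGroup A] [Module ℂ A]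
    (x : Fin 2 → Fin 2 → A) (i j k l : Fin 2) (c : ℂ) :
    (if j = k then (-1 : ℂ) ^ (par i l) • x i l else 0)
        - c • (if i = l then (-1 : ℂ) ^ (par k j) • x k j else 0)
      = ((-1 : ℂ) ^ (par i j) * (-1 : ℂ) ^ (par k l)) •
        ((if j = k then x i l else 0) - c • (if i = l then x k j else 0)) := by
  rw [smul_sub]
  congr 1
  · split_ifs with h
    · subst h; rw [sign_cancel]
    · simp
  · split_ifs with h
    · subst h
      rw [mul_comm, sign_cancel k i j, smul_comm]
    · simp

/-- The parity automorphism of `U(gl(1|1)[t])`: it is `1` on the even part and `-1` on the odd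
part, that is, `e_{ij}[r] ↦ (-1)^{|i|+|j|} e_{ij}[r]`. -/
def uParity : U →ₐ[ℂ] U :=
  liftU (FreeAlgebra.lift ℂ fun p => (-1 : ℂ) ^ (par p.1 p.2.1) • uE p.1 p.2.1 p.2.2) (by
      rintro _ _ ⟨i, j, k, l, r, s⟩
      have hg : ∀ i j r, (FreeAlgebra.lift ℂ
          fun p : Fin 2 × Fin 2 × ℕ => (-1 : ℂ) ^ (par p.1 p.2.1) • uE p.1 p.2.1 p.2.2)
          (gen i j r) = (-1 : ℂ) ^ (par i j) • uE i j r := by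
        intro i j r
        simp [gen]
      simp only [map_sub, map_mul, map_smul, apply_ite (FreeAlgebra.lift ℂ
          fun p : Fin 2 × Fin 2 × ℕ => (-1 : ℂ) ^ (par p.1 p.2.1) • uE p.1 p.2.1 p.2.2),
        map_zero, hg]
      rw [bracket_rhs_smul (fun i j => uE i j (r + s)), ← uE_bracket, smul_sub]
      simp only [smul_mul_smul_comm]
      rw [mul_comm ((-1 : ℂ) ^ par k l), smul_comm])

theorem uParity_uE (i j : Fin 2) (r : ℕ) :
    uParity (uE i j r) = (-1 : ℂ) ^ (par i j) • uE i j r := by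
  rw [uParity, uE, liftU_toU]
  simp [gen, uE]

theorem uParity_uParity (u : U) : uParity (uParity u) = u := by
  have h : uParity.comp uParity = AlgHom.id ℂ U := by
    apply U_hom_ext
    apply FreeAlgebra.hom_ext
    funext p
    obtain ⟨i, j, r⟩ := p
    change uParity (uParity (uE i j r)) = uE i j r
    rw [uParity_uE, map_smul, uParity_uE, smul_smul, ← mul_pow]
    simp
  exact DFunLike.congr_fun h u

/-! ### Modules over the current superalgebra -/

/-- The structure of a (ℤ/2-graded) `gl(1|1)[t]`-module on a complex vector space `M`.  The
grading is recorded by the parity operator, which is `1` on the even and `-1` on the odd part. -/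
structure CurrentRep (M : Type*) [AddCommGroup M] [Module ℂ M] where
  /-- the parity operator -/
  parity : Module.End ℂ M
  /-- the action of `e_{ij}[r]` -/
  e : Fin 2 → Fin 2 → ℕ → Module.End ℂ M
  parity_sq : parity * parity = 1
  parity_e : ∀ i j r, parity * e i j r = (-1 : ℂ) ^ (par i j) • (e i j r * parity)
  bracket : ∀ i j k l r s,
    e i j r * e k l s - (-1 : ℂ) ^ (par i j * par k l) • (e k l s * e i j r)
      = (if j = k then e i l (r + s) else 0)
        - (-1 : ℂ) ^ (par i j * par k l) • (if i = l then e k j (r + s) else 0)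

namespace CurrentRep

section

variable {M : Type*} [AddCommGroup M] [Module ℂ M] (ρ : CurrentRep M)

/-- The subspace of singular vectors, `{v | e_{12} v = 0}`, where `e_{12} = e_{12}[0]`. -/
def sing : Submodule ℂ M := LinearMap.ker (ρ.e 0 1 0)

/-- The coefficient of `x^{-(m+2)}` in the Gaudin transfer matrix
`H(x) = ½ ∑_{a,b} (-1)^{|b|} e_{ab}(x) e_{ba}(x)`, where `e_{ab}(x) = ∑_p e_{ab}[p] x^{-p-1}`. -/
def transfer (m : ℕ) : Module.End ℂ M :=
  (1 / 2 : ℂ) • ∑ a : Fin 2, ∑ b : Fin 2, (-1 : ℂ) ^ b.val •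
    ∑ p ∈ Finset.HasAntidiagonal.antidiagonal m, ρ.e a b p.1 * ρ.e b a p.2

/-- `v` is an eigenvector of the Gaudin transfer matrix with eigenvalue the series
`ξ(x) = ∑_{r ≥ 2} ξ_r x^{-r}`; Laurent series are taken in the variable `x⁻¹`, so that
`ξ.coeff r` is the coefficient of `x^{-r}`. -/
def IsEigenvector (ξ : ℂ⸨X⸩) (v : M) : Prop :=
  v ≠ 0 ∧ (∀ r : ℤ, r < 2 → ξ.coeff r = 0) ∧
    ∀ m : ℕ, ρ.transfer m v = ξ.coeff ((m : ℤ) + 2) • v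

/-- The transfer matrix has simple spectrum in the subspace `K`: eigenvectors in `K` that are not
proportional have different eigenvalues. -/
def SimpleSpectrum (K : Submodule ℂ M) : Prop :=
  ∀ v₁ ∈ K, ∀ v₂ ∈ K, ∀ ξ₁ ξ₂ : ℂ⸨X⸩, ρ.IsEigenvector ξ₁ v₁ → ρ.IsEigenvector ξ₂ v₂ →
    (¬ ∃ c : ℂ, c ≠ 0 ∧ v₁ = c • v₂) → ξ₁ ≠ ξ₂

/-- The eigenvectors of the transfer matrix in the subspace `K`, up to multiplication by a
nonzero constant. -/
def eigenlines (K : Submodule ℂ M) : Set (ℙ ℂ M) :=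
  {ℓ | ℓ.rep ∈ K ∧ ∃ ξ : ℂ⸨X⸩, ρ.IsEigenvector ξ ℓ.rep}

end

/-! #### Tensor products -/

section Tensor

variable {k : ℕ} {M : Fin k → Type*} [∀ s, AddCommGroup (M s)] [∀ s, Module ℂ (M s)]
  (ρ : ∀ s, CurrentRep (M s))

/-- The operator `γ^p ⊗ ⋯ ⊗ γ^p ⊗ X ⊗ 1 ⊗ ⋯ ⊗ 1` with `X` in the factor `s` and `γ` the parity
operators: the action of an operator `X` of parity `p` on the factor `s`, with the sign rule
`w₁ ⊗ ⋯ ⊗ w_k ↦ (-1)^{p(|w₁| + ⋯ + |w_{s-1}|)} w₁ ⊗ ⋯ ⊗ X w_s ⊗ ⋯ ⊗ w_k`. -/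
def slot (p : ℕ) (s : Fin k) (X : Module.End ℂ (M s)) : Module.End ℂ (⨂[ℂ] q, M q) :=
  PiTensorProduct.map
    (Function.update (fun q => if q < s then (ρ q).parity ^ p else 1) s X)

theorem slot_sub (p : ℕ) (s : Fin k) (X Y : Module.End ℂ (M s)) :
    slot ρ p s (X - Y) = slot ρ p s X - slot ρ p s Y := by
  have h := (PiTensorProduct.mapMultilinear ℂ M M).map_update_sub
    (fun q => if q < s then (ρ q).parity ^ p else 1) s X Y
  exact h

theorem slot_smul (p : ℕ) (s : Fin k) (c : ℂ) (X : Module.End ℂ (M s)) :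
    slot ρ p s (c • X) = c • slot ρ p s X :=
  PiTensorProduct.map_update_smul _ _ _ _

theorem slot_zero (p : ℕ) (s : Fin k) : slot ρ p s 0 = 0 := by
  have h := slot_smul ρ p s 0 0
  simpa using h

theorem slot_mul_same (p p' : ℕ) (s : Fin k) (X Y : Module.End ℂ (M s)) :
    slot ρ p s X * slot ρ p' s Y = slot ρ (p + p') s (X * Y) := by
  unfold slot
  rw [← PiTensorProduct.map_mul]
  congr 1
  funext q
  by_cases h : q = s
  · subst h; simp
  · by_cases h' : q < s <;> simp [h, h', pow_add]

theorem slot_congr {p p' : ℕ} (h : p % 2 = p' % 2) (s : Fin k) (X : Module.End ℂ (M s)) :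
    slot ρ p s X = slot ρ p' s X := by
  have key : ∀ q (n : ℕ), (ρ q).parity ^ n = (ρ q).parity ^ (n % 2) := by
    intro q n
    conv_lhs => rw [← Nat.mod_add_div n 2, pow_add, pow_mul, pow_two, (ρ q).parity_sq]
    simp
  unfold slot
  congr 2
  funext q
  rw [key q p, key q p', h]

theorem parity_pow_e {N : Type*} [AddCommGroup N] [Module ℂ N] (σ : CurrentRep N)
    (i j : Fin 2) (r p : ℕ) :
    σ.parity ^ p * σ.e i j r = (-1 : ℂ) ^ (par i j * p) • (σ.e i j r * σ.parity ^ p) := by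
  induction p with
  | zero => simp
  | succ p ih =>
    rw [pow_succ', mul_assoc, ih, mul_smul_comm, ← mul_assoc, σ.parity_e, smul_mul_assoc,
      smul_smul, mul_assoc, Nat.mul_succ, pow_add]

theorem slot_comm {s s' : Fin k} (h : s < s') (i j i' j' : Fin 2) (r r' : ℕ) :
    slot ρ (par i' j') s' ((ρ s').e i' j' r') * slot ρ (par i j) s ((ρ s).e i j r)
      = (-1 : ℂ) ^ (par i j * par i' j') •
        (slot ρ (par i j) s ((ρ s).e i j r) * slot ρ (par i' j') s' ((ρ s').e i' j' r')) := by
  have h1 : slot ρ (par i j) s ((ρ s).e i j r) * slot ρ (par i' j') s' ((ρ s').e i' j' r')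
      = PiTensorProduct.map (Function.update
        (fun q => (Function.update (fun q => if q < s then (ρ q).parity ^ par i j else 1) s
            ((ρ s).e i j r) q) *
          (Function.update (fun q => if q < s' then (ρ q).parity ^ par i' j' else 1) s'
            ((ρ s').e i' j' r') q)) s ((ρ s).e i j r * (ρ s).parity ^ par i' j')) := by
    unfold slot
    rw [← PiTensorProduct.map_mul]
    congr 1
    funext q
    by_cases hq : q = s
    · subst hq; simp [h.ne, h]
    · simp [hq]
  rw [h1, ← PiTensorProduct.map_update_smul, ← parity_pow_e]
  unfold slot
  rw [← PiTensorProduct.map_mul]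
  congr 1
  funext q
  by_cases hq : q = s
  · subst hq; simp [h.ne, h]
  · by_cases hq' : q = s'
    · subst hq'
      simp [hq, not_lt_of_gt h]
    · by_cases hlt : q < s
      · simp [hq, hq', hlt, hlt.trans h, ← pow_add, add_comm]
      · simp [hq, hq', hlt]

/-- The super tensor product of `gl(1|1)[t]`-modules, through the coproduct
`Δ(X) = X ⊗ 1 + 1 ⊗ X` for `X ∈ gl(1|1)[t]` and the sign rule for superspaces. -/
def tensor : CurrentRep (⨂[ℂ] q, M q) where
  parity := PiTensorProduct.map fun q => (ρ q).parity
  e i j r := ∑ s, slot ρ (par i j) s ((ρ s).e i j r)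
  parity_sq := by
    rw [← PiTensorProduct.map_mul]
    simp only [(ρ _).parity_sq]
    exact PiTensorProduct.map_one
  parity_e i j r := by
    rw [Finset.mul_sum, Finset.sum_mul, Finset.smul_sum]
    refine Finset.sum_congr rfl fun s _ => ?_
    have h1 : slot ρ (par i j) s ((ρ s).e i j r) * PiTensorProduct.map (fun q => (ρ q).parity)
        = PiTensorProduct.map (Function.update
          (fun q => (if q < s then (ρ q).parity ^ par i j else 1) * (ρ q).parity) s
            ((ρ s).e i j r * (ρ s).parity)) := by
      unfold slot
      rw [← PiTensorProduct.map_mul]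
      congr 1
      funext q
      by_cases hq : q = s
      · subst hq; simp
      · simp [hq]
    rw [h1, ← PiTensorProduct.map_update_smul, ← (ρ s).parity_e]
    unfold slot
    rw [← PiTensorProduct.map_mul]
    congr 1
    funext q
    by_cases hq : q = s
    · subst hq; simp
    · by_cases hlt : q < s
      · simp [hq, hlt, ← pow_succ, ← pow_succ']
      · simp [hq, hlt]
  bracket i j k' l r r' := by
    have hdiag : ∀ s : Fin k,
        slot ρ (par i j) s ((ρ s).e i j r) * slot ρ (par k' l) s ((ρ s).e k' l r')
          - (-1 : ℂ) ^ (par i j * par k' l) •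
            (slot ρ (par k' l) s ((ρ s).e k' l r') * slot ρ (par i j) s ((ρ s).e i j r))
        = (if j = k' then slot ρ (par i l) s ((ρ s).e i l (r + r')) else 0)
          - (-1 : ℂ) ^ (par i j * par k' l) •
            (if i = l then slot ρ (par k' j) s ((ρ s).e k' j (r + r')) else 0) := by
      intro s
      rw [slot_mul_same, slot_mul_same, add_comm (par k' l), ← slot_smul, ← slot_sub,
        (ρ s).bracket, slot_sub, slot_smul]
      congr 1
      · split_ifs with h
        · subst h
          exact slot_congr ρ (by simp only [par]; omega) s _
        · exact slot_zero ρ _ s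
      · congr 1
        split_ifs with h
        · subst h
          exact slot_congr ρ (by simp only [par]; omega) s _
        · exact slot_zero ρ _ s
    have hoff : ∀ s s' : Fin k, s ≠ s' →
        slot ρ (par i j) s ((ρ s).e i j r) * slot ρ (par k' l) s' ((ρ s').e k' l r')
          - (-1 : ℂ) ^ (par i j * par k' l) •
            (slot ρ (par k' l) s' ((ρ s').e k' l r') * slot ρ (par i j) s ((ρ s).e i j r))
        = 0 := by
      intro s s' hne
      rcases lt_or_gt_of_ne hne with h | h
      · rw [slot_comm ρ h, smul_smul, ← mul_pow]
        simp
      · rw [slot_comm ρ h, mul_comm (par k' l)]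
        simp
    have hsum : (∑ s, slot ρ (par i j) s ((ρ s).e i j r))
          * (∑ s, slot ρ (par k' l) s ((ρ s).e k' l r'))
          - (-1 : ℂ) ^ (par i j * par k' l) •
            ((∑ s, slot ρ (par k' l) s ((ρ s).e k' l r'))
              * (∑ s, slot ρ (par i j) s ((ρ s).e i j r)))
        = ∑ s, (slot ρ (par i j) s ((ρ s).e i j r) * slot ρ (par k' l) s ((ρ s).e k' l r')
          - (-1 : ℂ) ^ (par i j * par k' l) •
            (slot ρ (par k' l) s ((ρ s).e k' l r') * slot ρ (par i j) s ((ρ s).e i j r))) := by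
      rw [Finset.sum_mul_sum, Finset.sum_mul_sum, Finset.sum_comm (s := Finset.univ)
        (t := Finset.univ) (f := fun a b => slot ρ (par k' l) a ((ρ a).e k' l r')
          * slot ρ (par i j) b ((ρ b).e i j r)), Finset.smul_sum, ← Finset.sum_sub_distrib]
      refine Finset.sum_congr rfl fun s _ => ?_
      rw [Finset.smul_sum, ← Finset.sum_sub_distrib]
      exact Finset.sum_eq_single s (fun s' _ hs' => hoff s s' hs'.symm) (by simp)
    rw [hsum, Finset.sum_congr rfl fun s _ => hdiag s, Finset.sum_sub_distrib,
      ← Finset.smul_sum]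
    congr 1
    · split_ifs <;> simp
    · split_ifs <;> simp

end Tensor

end CurrentRep

/-! ### Rational functions of `x` as series in `x⁻¹` -/

/-- The variable `x`; Laurent series are taken in the variable `x⁻¹`. -/
def xL : ℂ⸨X⸩ := HahnSeries.single (-1) 1

/-- A polynomial `p(x)` as a Laurent series in `x⁻¹`.  Quotients of such series, formed in the
field of Laurent series, are the expansions at infinity of rational functions. -/
def polyL : ℂ[X] →+* ℂ⸨X⸩ := eval₂RingHom HahnSeries.C xL

/-- The derivative `d/dx` of Laurent series in `u = x⁻¹`, which is `- u² d/du`. -/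
def ddx (f : ℂ⸨X⸩) : ℂ⸨X⸩ := -(HahnSeries.single 2 1 * LaurentSeries.derivative ℂ f)

/-! ### Weyl modules -/

/-- The defining relations of the Weyl module `W_η`, as elements of `U(gl(1|1)[t])` that kill the
generator `w`: `e_{11}(x) w = (η'(x)/η(x)) w`, `e_{22}(x) w = e_{12}(x) w = 0` and
`(e_{21} ⊗ η(t)) w = 0`. -/
inductive IsWeylRelation (η : ℂ[X]) : U → Prop
  | e11 (r : ℕ) : IsWeylRelation η (uE 0 0 r
      - algebraMap ℂ U ((polyL (derivative η) / polyL η).coeff ((r : ℤ) + 1)))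
  | e22 (r : ℕ) : IsWeylRelation η (uE 1 1 r)
  | e12 (r : ℕ) : IsWeylRelation η (uE 0 1 r)
  | e21 : IsWeylRelation η (∑ i ∈ Finset.range (η.natDegree + 1), η.coeff i • uE 1 0 i)

/-- The left ideal generated by the relations of the Weyl module. -/
def weylIdeal (η : ℂ[X]) : Submodule U U := Submodule.span U {u | IsWeylRelation η u}

/-- The Weyl module `W_η = U(gl(1|1)[t]) w`, for `η` monic. -/
def Weyl (η : ℂ[X]) : Type := U ⧸ weylIdeal η

instance (η : ℂ[X]) : AddCommGroup (Weyl η) := inferInstanceAs (AddCommGroup (U ⧸ weylIdeal η))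

instance (η : ℂ[X]) : Module U (Weyl η) := inferInstanceAs (Module U (U ⧸ weylIdeal η))

instance (η : ℂ[X]) : Module ℂ (Weyl η) := inferInstanceAs (Module ℂ (U ⧸ weylIdeal η))

instance (η : ℂ[X]) : IsScalarTower ℂ U (Weyl η) :=
  inferInstanceAs (IsScalarTower ℂ U (U ⧸ weylIdeal η))

/-- The vector `u w` of the Weyl module, for `u ∈ U(gl(1|1)[t])` and `w` the generator. -/
def weylMk (η : ℂ[X]) (u : U) : Weyl η := Submodule.Quotient.mk u

theorem weylMk_surjective (η : ℂ[X]) : Function.Surjective (weylMk η) :=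
  Submodule.Quotient.mk_surjective _

theorem weylMk_smul (η : ℂ[X]) (c : ℂ) (u : U) : weylMk η (c • u) = c • weylMk η u := rfl

theorem weylMk_mul (η : ℂ[X]) (v u : U) : weylMk η (v * u) = v • weylMk η u := rfl

theorem weylIdeal_le_comap (η : ℂ[X]) :
    weylIdeal η ≤ (weylIdeal η).comap (uParity : U →+* U).toSemilinearMap := by
  refine Submodule.span_le.2 ?_
  intro u hu
  have hmem : u ∈ weylIdeal η := Submodule.subset_span hu
  change uParity u ∈ weylIdeal η
  have hsm : ∀ c : ℂ, c • u ∈ weylIdeal η := fun c => by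
    rw [Algebra.smul_def]
    exact (weylIdeal η).smul_mem (algebraMap ℂ U c) hmem
  have hc : ∃ c : ℂ, uParity u = c • u := by
    rcases hu with r | r | r | _
    · exact ⟨1, by rw [map_sub, uParity_uE, AlgHom.commutes]; simp [par]⟩
    · exact ⟨_, uParity_uE _ _ _⟩
    · exact ⟨_, uParity_uE _ _ _⟩
    · refine ⟨-1, ?_⟩
      rw [map_sum, Finset.smul_sum]
      refine Finset.sum_congr rfl fun i _ => ?_
      rw [map_smul, uParity_uE, smul_comm]
      norm_num [par]
  obtain ⟨c, hc⟩ := hc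
  rw [hc]
  exact hsm c

/-- The parity operator of the Weyl module, for which the generator `w` is even:
`u w ↦ γ(u) w`, with `γ` the parity automorphism. -/
def weylParity (η : ℂ[X]) : Module.End ℂ (Weyl η) where
  toFun := Submodule.mapQ (weylIdeal η) (weylIdeal η) (uParity : U →+* U).toSemilinearMap
    (weylIdeal_le_comap η)
  map_add' := map_add _
  map_smul' c x := by
    obtain ⟨u, rfl⟩ := weylMk_surjective η x
    change weylMk η (uParity (c • u)) = c • weylMk η (uParity u)
    rw [map_smul, weylMk_smul]

theorem weylParity_mk (η : ℂ[X]) (u : U) :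
    weylParity η (weylMk η u) = weylMk η (uParity u) := rfl

/-- The Weyl module `W_η` as a `gl(1|1)[t]`-module: `U(gl(1|1)[t])` acts by left
multiplication. -/
def weylRep (η : ℂ[X]) : CurrentRep (Weyl η) where
  parity := weylParity η
  e i j r := Algebra.lsmul ℂ ℂ (Weyl η) (uE i j r)
  parity_sq := by
    refine LinearMap.ext fun x => ?_
    obtain ⟨u, rfl⟩ := weylMk_surjective η x
    change weylParity η (weylParity η (weylMk η u)) = weylMk η u
    rw [weylParity_mk, weylParity_mk, uParity_uParity]
  parity_e i j r := by
    refine LinearMap.ext fun x => ?_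
    obtain ⟨u, rfl⟩ := weylMk_surjective η x
    change weylParity η (uE i j r • weylMk η u)
      = (-1 : ℂ) ^ (par i j) • (uE i j r • weylParity η (weylMk η u))
    rw [← weylMk_mul, weylParity_mk, weylParity_mk, ← weylMk_mul, ← weylMk_smul, map_mul,
      uParity_uE, smul_mul_assoc]
  bracket i j k l r s := by
    have h := congrArg (Algebra.lsmul ℂ ℂ (Weyl η)) (uE_bracket i j k l r s)
    simpa only [map_sub, map_mul, map_smul, apply_ite (Algebra.lsmul ℂ ℂ (Weyl η)), map_zero]
      using h

/-- `W_m(b) = W_η` for `η(x) = (x - b)^m`. -/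
def weylPt (m : ℕ) (b : ℂ) : CurrentRep (Weyl ((X - C b) ^ m)) := weylRep ((X - C b) ^ m)

/-- The tensor product `W_{n_1}(b_1) ⊗ ⋯ ⊗ W_{n_k}(b_k)`. -/
def weylTensor {k : ℕ} (n : Fin k → ℕ) (b : Fin k → ℂ) :
    CurrentRep (⨂[ℂ] s, Weyl ((X - C (b s)) ^ n s)) :=
  CurrentRep.tensor fun s => weylPt (n s) (b s)

/-! ### The eigenvalues -/

/-- `ζ(x) = ∑_s n_s / (x - b_s)`, expanded in `x⁻¹`. -/
def zeta {k : ℕ} (n : Fin k → ℕ) (b : Fin k → ℂ) : ℂ⸨X⸩ :=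
  ∑ s, (n s : ℂ⸨X⸩) / polyL (X - C (b s))

/-- The polynomial `ψ(x) = ζ(x) ∏_r (x - b_r)^{n_r}`. -/
def psi {k : ℕ} (n : Fin k → ℕ) (b : Fin k → ℂ) : ℂ[X] :=
  ∑ s, (n s : ℂ[X]) * (X - C (b s)) ^ (n s - 1) *
    ∏ r ∈ Finset.univ.erase s, (X - C (b r)) ^ n r

/-- The series `½ ζ'(x) - ζ(x) y'(x)/y(x) + ½ ζ(x)²`. -/
def eigenvalue {k : ℕ} (n : Fin k → ℕ) (b : Fin k → ℂ) (y : ℂ[X]) : ℂ⸨X⸩ :=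
  HahnSeries.C (1 / 2 : ℂ) * ddx (zeta n b)
    - zeta n b * (polyL (derivative y) / polyL y)
    + HahnSeries.C (1 / 2 : ℂ) * zeta n b ^ 2

theorem polyL_X_sub_C_ne_zero (c : ℂ) : polyL (X - C c) ≠ 0 := by
  intro h
  have h1 := congrArg (fun f : ℂ⸨X⸩ => f.coeff (-1)) h
  simp [polyL, xL, HahnSeries.C_apply] at h1

/-- The polynomial `psi` is `ζ(x) ∏_r (x - b_r)^{n_r}`. -/
theorem polyL_psi {k : ℕ} (n : Fin k → ℕ) (b : Fin k → ℂ) :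
    polyL (psi n b) = zeta n b * ∏ r, polyL (X - C (b r)) ^ n r := by
  rw [zeta, psi, Finset.sum_mul, map_sum]
  refine Finset.sum_congr rfl fun s _ => ?_
  have h0 := polyL_X_sub_C_ne_zero (b s)
  rw [← Finset.mul_prod_erase Finset.univ _ (Finset.mem_univ s)]
  simp only [map_mul, map_prod, map_pow, map_natCast]
  rcases Nat.eq_zero_or_pos (n s) with h | h
  · simp [h]
  · obtain ⟨m, hm⟩ := Nat.exists_eq_succ_of_ne_zero h.ne'
    rw [hm, Nat.succ_eq_add_one, Nat.add_sub_cancel, pow_succ]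
    field_simp

end GL11

end

/-!
By the Chinese remainder theorem, `⨂ W_{n_s}(b_s)` is generated by `w = ⨂ w_s` under the operators
`e₂₁ ⊗ p`, which anticommute and depend only on `p` modulo `η = ∏ (t - b_s) ^ n_s`; hence it is a
copy of the fermionic Fock space `Λ(ℂ[t]/η)`. There `e₁₂ ⊗ p` is the contraction with the linear
form `g ↦ tr(p g)` and `e₂₂ ⊗ p` is the derivation extending multiplication by `p`.

The singular vectors therefore form `Λ(ker tr)`, and `g ↦ [g η / η']`, with `[ ]` the polynomial
part, identifies `ℂ[t]/η'` with `ker tr`. In these terms the transfer matrix is, up to a scalar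
series, the second quantization of `-ζ(x) / (x - t)` on `ℂ[t]/η'`, so that its eigenvectors are the
joint eigenvectors of the second quantizations of the powers of `T`, multiplication by `t`.

By Newton's identities the eigenvalues of such a vector are the power sums of the roots of a monic
polynomial `y`, and the vector is supported on `ker y(T)`: it lies in `Λ^d (ker y(T))` with
`d = deg y`. Since `ker y(T)` has dimension `deg gcd(y, η')`, this forces `y ∣ η'`, and then
`Λ^d (ker y(T))` is a line.
-/

noncomputable section

namespace GL11

namespace Fock

open ExteriorAlgebra

section CommRing

variable {R V V' M : Type*} [CommRing R] [AddCommGroup V] [Module R V] [AddCommGroup V']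
  [Module R V'] [AddCommGroup M] [Module R M]

theorem linearMap_ext {f g : ExteriorAlgebra R V →ₗ[R] M} (one : f 1 = g 1)
    (ι_mul : ∀ v x, f x = g x → f (ι R v * x) = g (ι R v * x)) : f = g := by
  refine LinearMap.ext fun x => ?_
  induction x using CliffordAlgebra.left_induction with
  | algebraMap r => rw [Algebra.algebraMap_eq_smul_one, map_smul, map_smul, one]
  | add x y hx hy => rw [map_add, map_add, hx, hy]
  | ι_mul x v hx => exact ι_mul v x hx

theorem ι_mul_ι_mul (u v : V) (x : ExteriorAlgebra R V) :
    ι R u * (ι R v * x) = -(ι R v * (ι R u * x)) := by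
  rw [← mul_assoc, ← mul_assoc, ← neg_mul, eq_neg_of_add_eq_zero_left (ι_add_mul_swap u v)]

/-- Contraction of the exterior algebra with a linear form; on the fermionic Fock space `Λ V`
this is the annihilation operator adjoint to left multiplication by a vector. -/
def contract : Module.Dual R V →ₗ[R] Module.End R (ExteriorAlgebra R V) :=
  CliffordAlgebra.contractLeft

@[simp] theorem contract_one (φ : Module.Dual R V) : contract φ 1 = 0 :=
  CliffordAlgebra.contractLeft_one _ _

theorem contract_ι_mul (φ : Module.Dual R V) (v : V) (x : ExteriorAlgebra R V) :
    contract φ (ι R v * x) = φ v • x - ι R v * contract φ x :=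
  CliffordAlgebra.contractLeft_ι_mul φ v x

theorem contract_contract (φ χ : Module.Dual R V) (x : ExteriorAlgebra R V) :
    contract φ (contract χ x) = -contract χ (contract φ x) :=
  CliffordAlgebra.contractLeft_comm φ χ x

theorem contract_map (φ : Module.Dual R V') (f : V →ₗ[R] V') (x : ExteriorAlgebra R V) :
    contract φ (map f x) = map f (contract (φ ∘ₗ f) x) := by
  refine LinearMap.congr_fun (f := contract φ ∘ₗ (map f).toLinearMap)
    (g := (map f).toLinearMap ∘ₗ contract (φ ∘ₗ f)) (linearMap_ext (by simp) fun v x hx => ?_) x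
  simp only [LinearMap.comp_apply, AlgHom.toLinearMap_apply] at hx ⊢
  simp only [map_mul, map_apply_ι, contract_ι_mul, map_sub, map_smul, hx, LinearMap.comp_apply]

theorem map_id_sub_smulRight (φ : Module.Dual R V) (u : V) (x : ExteriorAlgebra R V) :
    map (LinearMap.id - φ.smulRight u : V →ₗ[R] V) x = x - ι R u * contract φ x := by
  refine LinearMap.congr_fun (f := (map (LinearMap.id - φ.smulRight u : V →ₗ[R] V)).toLinearMap)
    (g := LinearMap.id - LinearMap.mulLeft R (ι R u) * contract φ)
    (linearMap_ext (by simp) fun v x hx => ?_) x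
  simp only [LinearMap.sub_apply, Module.End.mul_apply, AlgHom.toLinearMap_apply,
    LinearMap.mulLeft_apply, LinearMap.id_apply] at hx ⊢
  have hu : ι R u * (ι R u * contract φ x) = 0 := by rw [← mul_assoc, ι_sq_zero, zero_mul]
  simp only [map_mul, map_apply_ι, hx, contract_ι_mul, LinearMap.sub_apply, LinearMap.id_apply,
    LinearMap.smulRight_apply, map_sub, map_smul, sub_mul, mul_sub, smul_mul_assoc,
    mul_smul_comm, ι_mul_ι_mul u v, hu]
  module

/-- The algebra homomorphism `Λ V → Λ V[ε]`, `v ↦ v + ε S v`. -/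
def dualLift (S : Module.End R V) : ExteriorAlgebra R V →ₐ[R] DualNumber (ExteriorAlgebra R V) :=
  lift R ⟨(TrivSqZeroExt.inlAlgHom R _ _).toLinearMap ∘ₗ ι R +
      (TrivSqZeroExt.inrHom (ExteriorAlgebra R V) _).restrictScalars R ∘ₗ ι R ∘ₗ S, fun v => by
    ext
    · simp
    · simp [ι_add_mul_swap]⟩

theorem fst_dualLift (S : Module.End R V) (x : ExteriorAlgebra R V) : (dualLift S x).fst = x := by
  refine AlgHom.congr_fun (φ₁ := (TrivSqZeroExt.fstHom R _ _).comp (dualLift S))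
    (φ₂ := AlgHom.id R _) (hom_ext ?_) x
  ext v
  simp [dualLift]

theorem snd_dualLift_ι_mul (S : Module.End R V) (v : V) (x : ExteriorAlgebra R V) :
    (dualLift S (ι R v * x)).snd = ι R (S v) * x + ι R v * (dualLift S x).snd := by
  have hv : dualLift S (ι R v) = TrivSqZeroExt.inl (ι R v) + TrivSqZeroExt.inr (ι R (S v)) := by
    simp [dualLift]
  rw [map_mul, hv, TrivSqZeroExt.snd_mul, fst_dualLift]
  simp [add_comm]

/-- The second quantization of an endomorphism `S` of `V`: the derivation of `Λ V` extending `S`,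
read off from `dualLift` as the coefficient of `ε`. -/
def dΓ : Module.End R V →ₗ[R] Module.End R (ExteriorAlgebra R V) where
  toFun S := (TrivSqZeroExt.sndHom (ExteriorAlgebra R V) _).restrictScalars R ∘ₗ
    (dualLift S).toLinearMap
  map_add' S S' := linearMap_ext (by simp) fun v x hx => by
    simp_all only [LinearMap.comp_apply, LinearMap.restrictScalars_apply, LinearMap.add_apply,
      AlgHom.toLinearMap_apply, TrivSqZeroExt.sndHom_apply, snd_dualLift_ι_mul, map_add,
      add_mul, mul_add]
    abel
  map_smul' c S := linearMap_ext (by simp) fun v x hx => by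
    simp_all only [LinearMap.comp_apply, LinearMap.restrictScalars_apply, LinearMap.smul_apply,
      AlgHom.toLinearMap_apply, TrivSqZeroExt.sndHom_apply, snd_dualLift_ι_mul, map_smul,
      smul_mul_assoc, mul_smul_comm, smul_add, RingHom.id_apply]

@[simp] theorem dΓ_one (S : Module.End R V) : dΓ S 1 = 0 := by simp [dΓ]

theorem dΓ_ι_mul (S : Module.End R V) (v : V) (x : ExteriorAlgebra R V) :
    dΓ S (ι R v * x) = ι R (S v) * x + ι R v * dΓ S x :=
  snd_dualLift_ι_mul S v x

theorem contract_dΓ (φ : Module.Dual R V) (S : Module.End R V) (x : ExteriorAlgebra R V) :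
    contract φ (dΓ S x) = dΓ S (contract φ x) + contract (φ ∘ₗ S) x := by
  refine LinearMap.congr_fun (f := contract φ * dΓ S)
    (g := dΓ S * contract φ + contract (φ ∘ₗ S)) (linearMap_ext (by simp) fun v x hx => ?_) x
  simp only [LinearMap.add_apply, Module.End.mul_apply] at hx ⊢
  simp only [dΓ_ι_mul, contract_ι_mul, map_add, map_sub, map_smul, hx, mul_add,
    LinearMap.comp_apply]
  abel

theorem dΓ_smulRight (φ : Module.Dual R V) (u : V) (x : ExteriorAlgebra R V) :
    dΓ (φ.smulRight u) x = ι R u * contract φ x := by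
  refine LinearMap.congr_fun (f := dΓ (φ.smulRight u))
    (g := LinearMap.mulLeft R (ι R u) * contract φ) (linearMap_ext (by simp) fun v x hx => ?_) x
  simp only [Module.End.mul_apply, LinearMap.mulLeft_apply] at hx ⊢
  rw [dΓ_ι_mul, hx, contract_ι_mul, mul_sub, ι_mul_ι_mul v u, LinearMap.smulRight_apply,
    map_smul, smul_mul_assoc, mul_smul_comm, sub_eq_add_neg]

theorem dΓ_map {S : Module.End R V'} {T : Module.End R V} {f : V →ₗ[R] V'}
    (h : S ∘ₗ f = f ∘ₗ T) (x : ExteriorAlgebra R V) : dΓ S (map f x) = map f (dΓ T x) := by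
  refine LinearMap.congr_fun (f := dΓ S ∘ₗ (map f).toLinearMap)
    (g := (map f).toLinearMap ∘ₗ dΓ T) (linearMap_ext (by simp) fun v x hx => ?_) x
  have hv : S (f v) = f (T v) := LinearMap.congr_fun h v
  simp only [LinearMap.comp_apply, AlgHom.toLinearMap_apply] at hx ⊢
  simp only [map_mul, map_apply_ι, dΓ_ι_mul, map_add, hx, hv]

theorem commute_dΓ {S S' : Module.End R V} (h : Commute S S') : Commute (dΓ S) (dΓ S') := by
  refine linearMap_ext (by simp) fun v x hx => ?_
  have hv : S (S' v) = S' (S v) := LinearMap.congr_fun h v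
  simp only [Module.End.mul_apply] at hx ⊢
  simp only [dΓ_ι_mul, map_add, hx, hv]
  abel

theorem dΓ_eq_sum {κ : Type*} [Fintype κ] (b : Module.Basis κ R V) (S : Module.End R V)
    (x : ExteriorAlgebra R V) : dΓ S x = ∑ i, ι R (S (b i)) * contract (b.coord i) x := by
  have hS : S = ∑ i, (b.coord i).smulRight (S (b i)) :=
    b.ext fun j => by classical simp [LinearMap.sum_apply, Finsupp.single_apply, ite_smul]
  conv_lhs => rw [hS, map_sum, LinearMap.sum_apply]
  exact Finset.sum_congr rfl fun i _ => dΓ_smulRight _ _ x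

theorem ι_mul_mem_exteriorPower {l : ℕ} (v : V) {x : ExteriorAlgebra R V} (hx : x ∈ ⋀[R]^l V) :
    ι R v * x ∈ ⋀[R]^(l + 1) V := by
  rw [exteriorPower, pow_succ']
  exact Submodule.mul_mem_mul (LinearMap.mem_range_self _ v) hx

@[elab_as_elim]
theorem exteriorPower_induction {P : ∀ (l : ℕ) (x : ExteriorAlgebra R V), x ∈ ⋀[R]^l V → Prop}
    (algebraMap : ∀ r, P 0 (algebraMap R _ r) (Submodule.algebraMap_mem r))
    (add : ∀ l x y hx hy, P l x hx → P l y hy → P l (x + y) (add_mem hx hy))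
    (ι_mul : ∀ l v x hx, P l x hx → P (l + 1) (ι R v * x) (ι_mul_mem_exteriorPower v hx))
    {l : ℕ} {x : ExteriorAlgebra R V} (hx : x ∈ ⋀[R]^l V) : P l x hx :=
  Submodule.pow_induction_on_left' _ (C := P) algebraMap (fun x y l => add l x y)
    (by rintro _ ⟨v, rfl⟩ l x hx; exact ι_mul l v x hx) hx

theorem map_mem_exteriorPower (f : V →ₗ[R] V') {l : ℕ} {x : ExteriorAlgebra R V}
    (hx : x ∈ ⋀[R]^l V) : map f x ∈ ⋀[R]^l V' := by
  induction hx using exteriorPower_induction with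
  | algebraMap r => simp
  | add l x y _ _ hx hy => rw [map_add]; exact add_mem hx hy
  | ι_mul l v x _ hx => rw [map_mul, map_apply_ι]; exact ι_mul_mem_exteriorPower _ hx

theorem contract_algebraMap (φ : Module.Dual R V) (r : R) :
    contract φ (algebraMap R _ r) = 0 :=
  CliffordAlgebra.contractLeft_algebraMap _ _ r

theorem dΓ_algebraMap (S : Module.End R V) (r : R) : dΓ S (algebraMap R _ r) = 0 := by
  rw [Algebra.algebraMap_eq_smul_one, map_smul, dΓ_one, smul_zero]

theorem contract_mem_exteriorPower (φ : Module.Dual R V) {l : ℕ} {x : ExteriorAlgebra R V}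
    (hx : x ∈ ⋀[R]^l V) : contract φ x ∈ ⋀[R]^(l - 1) V := by
  induction hx using exteriorPower_induction with
  | algebraMap r => simp [contract_algebraMap]
  | add l x y _ _ hx hy => rw [map_add]; exact add_mem hx hy
  | ι_mul l v x hx hφ =>
    rw [contract_ι_mul]
    refine sub_mem (Submodule.smul_mem _ _ hx) ?_
    rcases l with - | l
    · obtain ⟨r, rfl⟩ := Submodule.mem_one.1 hx
      simp [contract_algebraMap]
    · exact ι_mul_mem_exteriorPower v hφ

theorem dΓ_mem_exteriorPower (S : Module.End R V) {l : ℕ} {x : ExteriorAlgebra R V}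
    (hx : x ∈ ⋀[R]^l V) : dΓ S x ∈ ⋀[R]^l V := by
  induction hx using exteriorPower_induction with
  | algebraMap r => simp [dΓ_algebraMap]
  | add l x y _ _ hx hy => rw [map_add]; exact add_mem hx hy
  | ι_mul l v x hx hS =>
    rw [dΓ_ι_mul]
    exact add_mem (ι_mul_mem_exteriorPower _ hx) (ι_mul_mem_exteriorPower _ hS)

theorem dΓ_one_of_mem_exteriorPower {l : ℕ} {x : ExteriorAlgebra R V} (hx : x ∈ ⋀[R]^l V) :
    dΓ (1 : Module.End R V) x = (l : R) • x := by
  induction hx using exteriorPower_induction with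
  | algebraMap r => simp [dΓ_algebraMap]
  | add l x y _ _ hx hy => rw [map_add, hx, hy, smul_add]
  | ι_mul l v x hx h =>
    rw [dΓ_ι_mul, h, Module.End.one_apply]
    push_cast
    rw [mul_smul_comm]
    module

end CommRing

section Field

variable {K V : Type*} [Field K] [AddCommGroup V] [Module K V]

theorem proj_dΓ_one (l : ℕ) (x : ExteriorAlgebra K V) :
    GradedAlgebra.proj (fun i : ℕ => ⋀[K]^i V) l (dΓ (1 : Module.End K V) x) =
      (l : K) • GradedAlgebra.proj (fun i : ℕ => ⋀[K]^i V) l x := by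
  induction x using DirectSum.Decomposition.inductionOn (fun i : ℕ => ⋀[K]^i V) with
  | zero => simp
  | add x y hx hy => rw [map_add, map_add, hx, hy, map_add, smul_add]
  | @homogeneous i x =>
    rw [dΓ_one_of_mem_exteriorPower x.2, map_smul, GradedAlgebra.proj_apply]
    rcases eq_or_ne i l with rfl | h
    · rfl
    · rw [DirectSum.decompose_of_mem_ne (fun i : ℕ => ⋀[K]^i V) x.2 h, smul_zero, smul_zero]

/-- The part of `⋀^l V` supported on a subspace `W`, cut out by the vanishing of the contractions
with the linear forms that annihilate `W`; see `supported_eq_map`. -/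
def supported (W : Submodule K V) (l : ℕ) : Submodule K (ExteriorAlgebra K V) :=
  ⋀[K]^l V ⊓ ⨅ φ ∈ W.dualAnnihilator, LinearMap.ker (contract φ)

theorem mem_supported {W : Submodule K V} {l : ℕ} {x : ExteriorAlgebra K V} :
    x ∈ supported W l ↔ x ∈ ⋀[K]^l V ∧ ∀ φ ∈ W.dualAnnihilator, contract φ x = 0 := by
  simp [supported]

theorem contract_mem_supported {W : Submodule K V} {l : ℕ} {x : ExteriorAlgebra K V}
    (hx : x ∈ supported W l) (φ : Module.Dual K V) : contract φ x ∈ supported W (l - 1) := by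
  rw [mem_supported] at hx ⊢
  refine ⟨contract_mem_exteriorPower φ hx.1, fun χ hχ => ?_⟩
  rw [contract_contract, hx.2 χ hχ, map_zero, neg_zero]

theorem supported_inf (W W' : Submodule K V) (l : ℕ) :
    supported W l ⊓ supported W' l = supported (W ⊓ W') l := by
  refine le_antisymm (fun x hx => ?_) fun x hx => ?_
  · obtain ⟨⟨hl, h⟩, -, h'⟩ := And.imp mem_supported.1 mem_supported.1 hx
    refine mem_supported.2 ⟨hl, fun φ hφ => ?_⟩
    obtain ⟨φ₁, h₁, φ₂, h₂, rfl⟩ :=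
      Submodule.mem_sup.1 (Subspace.dualAnnihilator_inf_eq W W' ▸ hφ)
    rw [map_add, LinearMap.add_apply, h φ₁ h₁, h' φ₂ h₂, add_zero]
  · obtain ⟨hl, h⟩ := mem_supported.1 hx
    exact ⟨mem_supported.2 ⟨hl, fun φ hφ => h φ (Submodule.dualAnnihilator_anti inf_le_left hφ)⟩,
      mem_supported.2 ⟨hl, fun φ hφ => h φ (Submodule.dualAnnihilator_anti inf_le_right hφ)⟩⟩

variable [CharZero K]

theorem exists_mem_exteriorPower_of_dΓ_one {μ : K} {x : ExteriorAlgebra K V} (hx0 : x ≠ 0)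
    (hx : dΓ (1 : Module.End K V) x = μ • x) : ∃ l : ℕ, μ = l ∧ x ∈ ⋀[K]^l V := by
  have hproj : ∀ l : ℕ, μ = l ∨ GradedAlgebra.proj (fun i : ℕ => ⋀[K]^i V) l x = 0 := fun l => by
    rw [← sub_eq_zero, ← smul_eq_zero, sub_smul, ← map_smul, ← hx, proj_dΓ_one, sub_self]
  classical
  have hsum := DirectSum.sum_support_decompose (fun i : ℕ => ⋀[K]^i V) x
  obtain ⟨l, hl⟩ : ∃ l : ℕ, GradedAlgebra.proj (fun i : ℕ => ⋀[K]^i V) l x ≠ 0 := by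
    by_contra! h
    exact hx0 (hsum ▸ Finset.sum_eq_zero fun l _ => h l)
  have hμ := (hproj l).resolve_right hl
  refine ⟨l, hμ, hsum ▸ sum_mem fun i _ => ?_⟩
  rcases hproj i with hi | hi
  · rw [Nat.cast_injective (hμ.symm.trans hi)]
    exact SetLike.coe_mem _
  · rw [GradedAlgebra.proj_apply] at hi
    rw [hi]
    exact zero_mem _

theorem eq_zero_of_forall_contract_eq_zero [FiniteDimensional K V] {l : ℕ} (hl : l ≠ 0)
    {x : ExteriorAlgebra K V} (hx : x ∈ ⋀[K]^l V) (h : ∀ φ, contract φ x = 0) : x = 0 := by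
  have hΓ : dΓ (1 : Module.End K V) x = 0 := by simp [dΓ_eq_sum (Module.finBasis K V), h]
  rw [dΓ_one_of_mem_exteriorPower hx] at hΓ
  exact (smul_eq_zero.1 hΓ).resolve_left (Nat.cast_ne_zero.2 hl)

variable [FiniteDimensional K V]

theorem map_eq_self_of_mem_supported {W : Submodule K V} {π : Module.End K V}
    (hπ : ∀ w ∈ W, π w = w) {l : ℕ} {x : ExteriorAlgebra K V} (hx : x ∈ supported W l) :
    map π x = x := by
  induction l generalizing x with
  | zero =>
    obtain ⟨r, rfl⟩ := Submodule.mem_one.1 hx.1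
    simp
  | succ l ih =>
    have hmem := (mem_supported.1 hx).1
    rw [← sub_eq_zero]
    refine eq_zero_of_forall_contract_eq_zero l.succ_ne_zero (sub_mem ?_ hmem) fun φ => ?_
    · exact map_mem_exteriorPower π hmem
    · have hφ : φ ∘ₗ π - φ ∈ W.dualAnnihilator := by
        rw [Submodule.mem_dualAnnihilator]
        intro w hw
        simp [hπ w hw]
      have hφx : contract (φ ∘ₗ π) x = contract φ x := by
        rw [← sub_eq_zero, ← LinearMap.sub_apply, ← map_sub, (mem_supported.1 hx).2 _ hφ]
      rw [map_sub, contract_map, hφx, ih (contract_mem_supported hx φ), sub_self]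

theorem supported_eq_map (W : Submodule K V) (l : ℕ) :
    supported W l = (⋀[K]^l W).map (map W.subtype).toLinearMap := by
  refine le_antisymm (fun x hx => ?_) ?_
  · obtain ⟨p, hp⟩ := W.subtype.exists_leftInverse_of_injective W.ker_subtype
    refine ⟨map p x, map_mem_exteriorPower p (mem_supported.1 hx).1, ?_⟩
    change map W.subtype (map p x) = x
    rw [← AlgHom.comp_apply, map_comp_map]
    exact map_eq_self_of_mem_supported (fun w hw => by
      simpa using congrArg Subtype.val (LinearMap.congr_fun hp ⟨w, hw⟩)) hx
  · rintro _ ⟨x, hx, rfl⟩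
    refine mem_supported.2 ⟨map_mem_exteriorPower _ hx, fun φ hφ => ?_⟩
    have h0 : φ ∘ₗ W.subtype = 0 := LinearMap.ext fun w =>
      (Submodule.mem_dualAnnihilator φ).1 hφ w w.2
    rw [AlgHom.toLinearMap_apply, contract_map, h0, map_zero, LinearMap.zero_apply, map_zero]

theorem finrank_supported (W : Submodule K V) (l : ℕ) :
    Module.finrank K (supported W l) = (Module.finrank K W).choose l := by
  rw [supported_eq_map, ← (Submodule.equivMapOfInjective _
    (map_injective_field W.ker_subtype) _).finrank_eq, exteriorPower.finrank_eq]

end Field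

end Fock

section Newton

variable (K : Type*) {A M : Type*} [Field K] [Ring A] [Algebra K A] [AddCommGroup M] [Module K M]

/-- The signed elementary symmetric functions `(-1) ^ k e_k`, as polynomials in the power sums
`P 1, P 2, …` given by Newton's identities. -/
def newton (P : ℕ → A) : ℕ → A
  | 0 => 1
  | k + 1 => -((k + 1 : K)⁻¹ • ∑ i : Fin (k + 1), newton P i * P (k + 1 - i))

@[simp] theorem newton_zero (P : ℕ → A) : newton K P 0 = 1 := by rw [newton]

theorem cast_smul_newton [CharZero K] (P : ℕ → A) (k : ℕ) :
    (k : K) • newton K P k = -∑ i ∈ Finset.range k, newton K P i * P (k - i) := by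
  cases k with
  | zero => simp
  | succ k =>
    rw [newton, smul_neg, Nat.cast_succ, smul_inv_smul₀ (Nat.cast_add_one_ne_zero k),
      Finset.sum_range fun i => newton K P i * P (k + 1 - i)]

theorem newton_unique [CharZero K] {P C : ℕ → A} (zero : C 0 = 1)
    (rec : ∀ k : ℕ, (k : K) • C k = -∑ i ∈ Finset.range k, C i * P (k - i)) (k : ℕ) :
    newton K P k = C k := by
  induction k using Nat.strong_induction_on with
  | _ k ih =>
    rcases eq_or_ne k 0 with rfl | hk
    · rw [newton_zero, zero]
    · refine smul_right_injective A (Nat.cast_ne_zero (R := K).2 hk) ?_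
      simp only [cast_smul_newton, rec]
      rw [Finset.sum_congr rfl fun i hi => by rw [ih i (Finset.mem_range.1 hi)]]

theorem eq_of_newton_eq [CharZero K] {P Q : ℕ → A} (h : newton K P = newton K Q)
    {r : ℕ} (hr : r ≠ 0) : P r = Q r := by
  induction r using Nat.strong_induction_on with
  | _ r ih =>
    obtain ⟨r, rfl⟩ := Nat.exists_eq_succ_of_ne_zero hr
    have hsum := cast_smul_newton K P (r + 1)
    rw [h, cast_smul_newton K Q (r + 1)] at hsum
    have ih' : ∀ i ∈ Finset.range r, newton K Q (i + 1) * Q (r + 1 - (i + 1)) =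
        newton K Q (i + 1) * P (r + 1 - (i + 1)) := fun i hi => by
      rw [Finset.mem_range] at hi
      rw [ih (r + 1 - (i + 1)) (by omega) (by omega)]
    rw [neg_inj, Finset.sum_range_succ', Finset.sum_range_succ', Finset.sum_congr rfl ih'] at hsum
    simpa using hsum.symm

variable {K}

theorem cast_smul_newton_apply [CharZero K] (P : ℕ → Module.End K M) (k : ℕ) (x : M) :
    (k : K) • newton K P k x = -∑ i ∈ Finset.range k, newton K P i (P (k - i) x) := by
  rw [← LinearMap.smul_apply, cast_smul_newton, LinearMap.neg_apply, LinearMap.sum_apply]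
  rfl

theorem newton_apply_mem {P : ℕ → Module.End K M} {N : Submodule K M}
    (hP : ∀ r, ∀ x ∈ N, P r x ∈ N) (k : ℕ) {x : M} (hx : x ∈ N) : newton K P k x ∈ N := by
  induction k using Nat.strong_induction_on generalizing x with
  | _ k ih =>
    cases k with
    | zero => simpa using hx
    | succ k =>
      rw [newton, LinearMap.neg_apply, LinearMap.smul_apply, LinearMap.sum_apply]
      exact neg_mem (N.smul_mem _ (sum_mem fun i _ => ih i i.2 (hP _ x hx)))

theorem newton_apply_eq_smul {P : ℕ → Module.End K M} {p : ℕ → K} {x : M}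
    (hP : ∀ r, P r x = p r • x) (k : ℕ) : newton K P k x = newton K p k • x := by
  induction k using Nat.strong_induction_on with
  | _ k ih =>
    cases k with
    | zero => simp
    | succ k =>
      rw [newton, newton, LinearMap.neg_apply, LinearMap.smul_apply, LinearMap.sum_apply, neg_smul,
        smul_assoc, Finset.sum_smul]
      congr 2
      refine Finset.sum_congr rfl fun i _ => ?_
      rw [Module.End.mul_apply, hP, map_smul, ih i i.2, smul_smul, mul_comm]

end Newton

section RootPsum

variable {K : Type*} [Field K]

/-- The power sums `∑ a ^ r` over the roots of a polynomial. -/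
def rootPsum (y : K[X]) (r : ℕ) : K := (y.roots.map (· ^ r)).sum

theorem rootPsum_zero {y : K[X]} (hy : y.Splits) : rootPsum y 0 = y.natDegree := by
  simp [rootPsum, hy.natDegree_eq_card_roots]

/-- The polynomial `c₀ X ^ k + c₁ X ^ (k - 1) + ⋯ + c_k`, in Horner form. -/
def horner (c : ℕ → K) : ℕ → K[X]
  | 0 => C (c 0)
  | k + 1 => X * horner c k + C (c (k + 1))

theorem coeff_horner (c : ℕ → K) (k j : ℕ) :
    (horner c k).coeff j = if j ≤ k then c (k - j) else 0 := by
  induction k generalizing j with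
  | zero => cases j <;> simp [horner, coeff_C]
  | succ k ih => cases j <;> simp [horner, coeff_C, ih]

theorem monic_horner {c : ℕ → K} (hc : c 0 = 1) (k : ℕ) : (horner c k).Monic :=
  monic_of_degree_le k ((degree_le_iff_coeff_zero _ _).2 fun j hj => by
    rw [coeff_horner, if_neg (by exact_mod_cast hj.not_ge)]) (by simp [coeff_horner, hc])

theorem natDegree_horner {c : ℕ → K} (hc : c 0 = 1) (k : ℕ) : (horner c k).natDegree = k :=
  natDegree_eq_of_le_of_coeff_ne_zero
    (natDegree_le_iff_coeff_eq_zero.2 fun j hj => by rw [coeff_horner, if_neg hj.not_ge])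
    (by simp [coeff_horner, hc])

theorem coeff_reverse_horner {c : ℕ → K} (hc : c 0 = 1) (k j : ℕ) :
    (horner c k).reverse.coeff j = if j ≤ k then c j else 0 := by
  rw [coeff_reverse, natDegree_horner hc, coeff_horner]
  rcases le_or_gt j k with h | h
  · rw [revAt_le h, if_pos (Nat.sub_le k j), if_pos h, Nat.sub_sub_self h]
  · rw [revAt_eq_self_of_lt h]
    simp only [h.not_ge, if_false]

variable [CharZero K]

theorem rootPsum_zero_ne_zero [IsAlgClosed K] {y : K[X]} (hy : y.natDegree ≠ 0) :
    rootPsum y 0 ≠ 0 := by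
  rw [rootPsum_zero (IsAlgClosed.splits y)]
  exact Nat.cast_ne_zero.2 hy

theorem newton_psum (s : Multiset K) (k : ℕ) :
    newton K (fun r => (s.map (· ^ r)).sum) k = (-1) ^ k * s.esymm k := by
  classical
  refine newton_unique K (C := fun k => (-1) ^ k * s.esymm k) (by simp [Multiset.esymm])
    (fun k => ?_) k
  have h := congrArg (MvPolynomial.aeval fun a : s => (a : K))
    (MvPolynomial.mul_esymm_eq_sum s K k)
  have hp (r : ℕ) : ∑ a : s, (a : K) ^ r = (s.map (· ^ r)).sum :=
    congrArg Multiset.sum (Multiset.map_univ s (· ^ r))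
  have hsum (f : ℕ → ℕ → K) :
      ∑ a ∈ Finset.HasAntidiagonal.antidiagonal k with a.1 < k, f a.1 a.2 =
        ∑ i ∈ Finset.range k, f i (k - i) := by
    rw [Finset.sum_filter, Finset.Nat.sum_antidiagonal_eq_sum_range_succ fun i j =>
      if i < k then f i j else 0, Finset.sum_range_succ, if_neg (lt_irrefl k), add_zero]
    exact Finset.sum_congr rfl fun i hi => if_pos (Finset.mem_range.1 hi)
  simp only [map_mul, map_natCast, map_pow, map_neg, map_one, map_sum,
    MvPolynomial.aeval_esymm_eq_multiset_esymm, MvPolynomial.psum, MvPolynomial.aeval_X, hp,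
    Multiset.map_univ_coe] at h
  rw [hsum fun i j => (-1) ^ i * s.esymm i * (s.map (· ^ j)).sum] at h
  rw [smul_eq_mul, mul_left_comm, h, pow_succ, ← mul_assoc, mul_neg_one, mul_neg, ← mul_pow]
  simp

theorem newton_rootPsum {y : K[X]} (hm : y.Monic) (hy : y.Splits) (k : ℕ) :
    newton K (rootPsum y) k = y.reverse.coeff k := by
  rw [show rootPsum y = fun r => (y.roots.map (· ^ r)).sum from rfl, newton_psum, coeff_reverse]
  have hcard := hy.natDegree_eq_card_roots
  rcases le_or_gt k y.natDegree with hk | hk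
  · rw [revAt_le hk, coeff_eq_esymm_roots_of_card hcard.symm (Nat.sub_le _ _), hm.leadingCoeff,
      Nat.sub_sub_self hk, one_mul]
  · rw [revAt_eq_self_of_lt hk, coeff_eq_zero_of_natDegree_lt hk, Multiset.esymm,
      Multiset.powersetCard_eq_empty _ (hcard ▸ hk)]
    simp

theorem eq_of_rootPsum_eq {y z : K[X]} (hy : y.Monic) (hys : y.Splits) (hz : z.Monic)
    (hzs : z.Splits) (h : rootPsum y = rootPsum z) : y = z := by
  have hdeg : y.natDegree = z.natDegree := by
    have := congrFun h 0
    rw [rootPsum_zero hys, rootPsum_zero hzs] at this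
    exact_mod_cast this
  have hrev : y.reverse = z.reverse := Polynomial.ext fun k => by
    rw [← newton_rootPsum hy hys, h, newton_rootPsum hz hzs]
  rw [reverse, reverse, hdeg] at hrev
  ext k
  have hk := congrArg (coeff · (revAt z.natDegree k)) hrev
  simpa only [coeff_reflect, revAt_invol] using hk

end RootPsum

namespace Fock

variable {K V : Type*} [Field K] [CharZero K] [AddCommGroup V] [Module K V]

theorem contract_newton (T : Module.End K V) (φ : Module.Dual K V) (k : ℕ)
    (x : ExteriorAlgebra K V) :
    contract φ (newton K (fun r => dΓ (T ^ r)) (k + 1) x) =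
      newton K (fun r => dΓ (T ^ r)) (k + 1) (contract φ x) -
        newton K (fun r => dΓ (T ^ r)) k (contract (φ ∘ₗ T) x) := by
  induction k using Nat.strong_induction_on generalizing φ x with
  | _ k ih =>
  set P : ℕ → Module.End K (ExteriorAlgebra K V) := fun r => dΓ (T ^ r)
  have hcontract (ψ : Module.Dual K V) (r : ℕ) :
      contract ψ (P r x) = P r (contract ψ x) + contract (ψ ∘ₗ T ^ r) x := contract_dΓ ψ _ x
  let a : ℕ → ExteriorAlgebra K V := fun j => newton K P j (contract (φ ∘ₗ T ^ (k + 1 - j)) x)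
  have hterm : ∀ j ∈ Finset.range k, contract φ (newton K P (j + 1) (P (k + 1 - (j + 1)) x)) =
      newton K P (j + 1) (P (k + 1 - (j + 1)) (contract φ x)) -
        newton K P j (P (k - j) (contract (φ ∘ₗ T) x)) + (a (j + 1) - a j) := fun j hj => by
    have hjk := Finset.mem_range.1 hj
    have hpow : (φ ∘ₗ T) ∘ₗ T ^ (k - j) = φ ∘ₗ T ^ (k + 1 - j) := by
      rw [LinearMap.comp_assoc, ← Module.End.mul_eq_comp, ← pow_succ', ← Nat.sub_add_comm hjk.le]
    rw [ih j hjk, Nat.add_sub_add_right, hcontract, hcontract, hpow, map_add, map_add]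
    simp only [a, Nat.add_sub_add_right]
    abel
  have hak : a k = newton K P k (contract (φ ∘ₗ T) x) := by
    simp only [a, Nat.add_sub_cancel_left, pow_one]
  have ha0 : contract φ (P (k + 1) x) = P (k + 1) (contract φ x) + a 0 := by
    simp only [hcontract, a, newton_zero, Module.End.one_apply, Nat.sub_zero]
  refine smul_right_injective _ (Nat.cast_ne_zero (R := K).2 k.succ_ne_zero) ?_
  change ((k + 1 : ℕ) : K) • _ = ((k + 1 : ℕ) : K) • _
  have hk := cast_smul_newton_apply P k (contract (φ ∘ₗ T) x)
  rw [smul_sub, ← map_smul, cast_smul_newton_apply, cast_smul_newton_apply, Nat.cast_succ,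
    add_smul, hk, one_smul, ← hak, map_neg, map_sum, Finset.sum_range_succ',
    Finset.sum_range_succ', Finset.sum_congr rfl hterm, Finset.sum_add_distrib,
    Finset.sum_sub_distrib, Finset.sum_range_sub]
  simp only [newton_zero, Module.End.one_apply, Nat.sub_zero, ha0]
  abel

theorem newton_apply_eq_zero_of_mem_exteriorPower [FiniteDimensional K V] (T : Module.End K V)
    {l k : ℕ} (hlk : l < k) {x : ExteriorAlgebra K V} (hx : x ∈ ⋀[K]^l V) :
    newton K (fun r => dΓ (T ^ r)) k x = 0 := by
  induction l generalizing k x with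
  | zero =>
    obtain ⟨k, rfl⟩ := Nat.exists_eq_succ_of_ne_zero hlk.ne_bot
    obtain ⟨r, rfl⟩ := Submodule.mem_one.1 (by simpa using hx)
    simp [newton, dΓ_algebraMap]
  | succ l ih =>
    obtain ⟨k, rfl⟩ : ∃ j, k = j + 2 := ⟨k - 2, by omega⟩
    refine eq_zero_of_forall_contract_eq_zero l.succ_ne_zero
      (newton_apply_mem (fun r z hz => dΓ_mem_exteriorPower _ hz) _ hx) fun φ => ?_
    have hcontract (ψ : Module.Dual K V) : contract ψ x ∈ ⋀[K]^l V :=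
      contract_mem_exteriorPower ψ hx
    rw [contract_newton, ih (by omega) (hcontract _), ih (by omega) (hcontract _), sub_zero]

/-- A joint eigenvector, in the Fock space `Λ V`, of the second quantizations of all powers of
the one-particle operator `T`. -/
structure IsJointEigenvector (T : Module.End K V) (p : ℕ → K) (x : ExteriorAlgebra K V) :
    Prop where
  ne_zero : x ≠ 0
  apply (r : ℕ) : dΓ (T ^ r) x = p r • x

namespace IsJointEigenvector

variable {T : Module.End K V} {p : ℕ → K} {x : ExteriorAlgebra K V}

theorem contract_comp_aeval_horner (hx : IsJointEigenvector T p x) (φ : Module.Dual K V) (k : ℕ) :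
    contract (φ ∘ₗ aeval T (horner (newton K p) k)) x =
      newton K (fun r => dΓ (T ^ r)) k (contract φ x) := by
  induction k generalizing φ with
  | zero => simp [horner, Module.End.one_eq_id]
  | succ k ih =>
    have haeval : φ ∘ₗ aeval T (horner (newton K p) (k + 1)) =
        (φ ∘ₗ T) ∘ₗ aeval T (horner (newton K p) k) + newton K p (k + 1) • φ := by
      ext v
      simp [horner]
    have hk := contract_newton T φ k x
    rw [newton_apply_eq_smul hx.apply, map_smul] at hk
    rw [haeval, map_add, LinearMap.add_apply, ih, map_smul, LinearMap.smul_apply, hk,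
      add_sub_cancel]

theorem exists_eq_rootPsum [IsAlgClosed K] [FiniteDimensional K V]
    (hx : IsJointEigenvector T p x) :
    ∃ y : K[X], y.Monic ∧ p = rootPsum y ∧
      x ∈ supported (LinearMap.ker (aeval T y)) y.natDegree := by
  obtain ⟨l, hp0, hl⟩ := exists_mem_exteriorPower_of_dΓ_one hx.ne_zero (hx.apply 0)
  have hdeg := natDegree_horner (newton_zero K p) l
  have hmonic := monic_horner (newton_zero K p) l
  refine ⟨horner (newton K p) l, hmonic, funext fun r => ?_,
    mem_supported.2 ⟨hdeg.symm ▸ hl, fun φ hφ => ?_⟩⟩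
  · rcases eq_or_ne r 0 with rfl | hr
    · rw [rootPsum_zero (IsAlgClosed.splits _), hdeg, hp0]
    · refine eq_of_newton_eq K (funext fun k => ?_) hr
      rw [newton_rootPsum hmonic (IsAlgClosed.splits _), coeff_reverse_horner (newton_zero K p)]
      split_ifs with hk
      · rfl
      · have h := newton_apply_eq_zero_of_mem_exteriorPower T (not_le.1 hk) hl
        rw [newton_apply_eq_smul hx.apply] at h
        exact (smul_eq_zero.1 h).resolve_right hx.ne_zero
  · rw [← LinearMap.range_dualMap_eq_dualAnnihilator_ker] at hφ
    obtain ⟨ψ, rfl⟩ := hφ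
    have h := hx.contract_comp_aeval_horner ψ l
    rcases Nat.eq_zero_or_pos l with rfl | hl0
    · obtain ⟨r, rfl⟩ := Submodule.mem_one.1 (by simpa using hl)
      exact contract_algebraMap _ _
    · exact h.trans (newton_apply_eq_zero_of_mem_exteriorPower T (by omega)
        (contract_mem_exteriorPower ψ hl))

end IsJointEigenvector

end Fock

namespace Fock

section Supported

variable {K V : Type*} [Field K] [AddCommGroup V] [Module K V] {W : Submodule K V} {l : ℕ}
  {x : ExteriorAlgebra K V}

theorem dΓ_mem_supported {S : Module.End K V} (hS : ∀ w ∈ W, S w ∈ W) (hx : x ∈ supported W l) :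
    dΓ S x ∈ supported W l := by
  rw [mem_supported] at hx ⊢
  refine ⟨dΓ_mem_exteriorPower S hx.1, fun φ hφ => ?_⟩
  have hφS : φ ∘ₗ S ∈ W.dualAnnihilator := (Submodule.mem_dualAnnihilator _).2 fun w hw =>
    (Submodule.mem_dualAnnihilator φ).1 hφ _ (hS w hw)
  rw [contract_dΓ, hx.2 φ hφ, hx.2 _ hφS, map_zero, add_zero]

theorem le_finrank_of_mem_supported [CharZero K] [FiniteDimensional K V] (hx0 : x ≠ 0)
    (hx : x ∈ supported W l) : l ≤ Module.finrank K W := by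
  by_contra! h
  have hfin : Module.finrank K (supported W l) = 0 := by
    rw [finrank_supported, Nat.choose_eq_zero_of_lt h]
  rw [supported_eq_map] at hfin hx
  exact hx0 ((Submodule.mem_bot K).1 (Submodule.finrank_eq_zero.1 hfin ▸ hx))

end Supported

end Fock

section AdjoinRoot

variable {K : Type*} [Field K]

theorem ker_aeval_inf_le {V : Type*} [AddCommGroup V] [Module K V] [DecidableEq K]
    (T : Module.End K V) (p q : K[X]) :
    LinearMap.ker (aeval T p) ⊓ LinearMap.ker (aeval T q) ≤
      LinearMap.ker (aeval T (EuclideanDomain.gcd p q)) := by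
  rintro v ⟨hp, hq⟩
  rw [SetLike.mem_coe, LinearMap.mem_ker] at hp hq
  rw [LinearMap.mem_ker, EuclideanDomain.gcd_eq_gcd_ab, mul_comm p, mul_comm q, map_add, map_mul,
    map_mul, LinearMap.add_apply, Module.End.mul_apply, Module.End.mul_apply, hp, hq, map_zero,
    map_zero, add_zero]

/-- Multiplication by `X` on `K[X] / (χ)`. -/
def rootMul (χ : K[X]) : Module.End K (AdjoinRoot χ) :=
  Algebra.lmul K _ (AdjoinRoot.root χ)

theorem aeval_rootMul (χ y : K[X]) (g : AdjoinRoot χ) :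
    aeval (rootMul χ) y g = AdjoinRoot.mk χ y * g := by
  rw [rootMul, aeval_algHom_apply, AdjoinRoot.aeval_eq]
  rfl

theorem rootMul_pow_apply (χ : K[X]) (r : ℕ) (g : AdjoinRoot χ) :
    (rootMul χ ^ r) g = AdjoinRoot.root χ ^ r * g := by
  rw [rootMul, ← map_pow]
  rfl

theorem finrank_adjoinRoot {χ : K[X]} (hχ : χ ≠ 0) :
    Module.finrank K (AdjoinRoot χ) = χ.natDegree := by
  rw [(AdjoinRoot.powerBasis hχ).finrank, AdjoinRoot.powerBasis_dim]

theorem finiteDimensional_adjoinRoot {χ : K[X]} (hχ : χ ≠ 0) :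
    FiniteDimensional K (AdjoinRoot χ) :=
  (AdjoinRoot.powerBasis hχ).finite

theorem finrank_ker_aeval_rootMul {χ y : K[X]} (hχ : χ ≠ 0) (hy : y ∣ χ) :
    Module.finrank K (LinearMap.ker (aeval (rootMul χ) y)) = y.natDegree := by
  obtain ⟨z, rfl⟩ := hy
  obtain ⟨hy0, hz0⟩ := mul_ne_zero_iff.1 hχ
  have := finiteDimensional_adjoinRoot hχ
  let f : AdjoinRoot (y * z) →ₗ[K] AdjoinRoot z :=
    (AdjoinRoot.algHomOfDvd K (y * z) z (dvd_mul_left z y)).toLinearMap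
  have hf (g : K[X]) : f (AdjoinRoot.mk (y * z) g) = AdjoinRoot.mk z g :=
    (aeval_def _ g).symm.trans (AdjoinRoot.aeval_eq g)
  have hker : LinearMap.ker (aeval (rootMul (y * z)) y) = LinearMap.ker f := by
    ext g
    obtain ⟨g, rfl⟩ := AdjoinRoot.mk_surjective g
    rw [LinearMap.mem_ker, LinearMap.mem_ker, aeval_rootMul, hf, ← map_mul, AdjoinRoot.mk_eq_zero,
      AdjoinRoot.mk_eq_zero, mul_dvd_mul_iff_left hy0]
  have hsurj : Function.Surjective f := fun g => by
    obtain ⟨g, rfl⟩ := AdjoinRoot.mk_surjective g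
    exact ⟨_, hf g⟩
  have hdim := f.finrank_range_add_finrank_ker
  rw [LinearMap.range_eq_top.2 hsurj, finrank_top, finrank_adjoinRoot hz0,
    finrank_adjoinRoot hχ, natDegree_mul hy0 hz0] at hdim
  rw [hker]
  omega

theorem ker_aeval_rootMul_self (χ : K[X]) : LinearMap.ker (aeval (rootMul χ) χ) = ⊤ :=
  LinearMap.ker_eq_top.2 (LinearMap.ext fun g => by
    rw [aeval_rootMul, AdjoinRoot.mk_self, zero_mul, LinearMap.zero_apply])

end AdjoinRoot

namespace Fock

variable {K : Type*} [Field K] [CharZero K] {χ y : K[X]} {p : ℕ → K}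
  {x x' : ExteriorAlgebra K (AdjoinRoot χ)}

theorem dvd_of_mem_supported_ker (hχ : χ ≠ 0) (hy : y ≠ 0) {z : K[X]} (hz : z ∣ χ) (hx0 : x ≠ 0)
    (hx : x ∈ supported (LinearMap.ker (aeval (rootMul χ) y) ⊓
      LinearMap.ker (aeval (rootMul χ) z)) y.natDegree) : y ∣ z := by
  classical
  have := finiteDimensional_adjoinRoot hχ
  have hdvd := EuclideanDomain.gcd_dvd_right y z
  have hle := (le_finrank_of_mem_supported hx0 hx).trans
    (Submodule.finrank_mono (ker_aeval_inf_le _ y z))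
  rw [finrank_ker_aeval_rootMul hχ (hdvd.trans hz)] at hle
  exact (associated_of_dvd_of_natDegree_le (EuclideanDomain.gcd_dvd_left y z) hy
    hle).symm.dvd.trans hdvd

theorem finrank_supported_ker (hχ : χ ≠ 0) (hy : y ∣ χ) :
    Module.finrank K (supported (LinearMap.ker (aeval (rootMul χ) y)) y.natDegree) = 1 := by
  have := finiteDimensional_adjoinRoot hχ
  rw [finrank_supported, finrank_ker_aeval_rootMul hχ hy, Nat.choose_self]

theorem exists_isJointEigenvector_mem_supported (hχ : χ ≠ 0) (hy : y ∣ χ) :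
    ∃ x ∈ supported (LinearMap.ker (aeval (rootMul χ) y)) y.natDegree, ∃ p : ℕ → K,
      IsJointEigenvector (rootMul χ) p x := by
  obtain ⟨⟨x, hx⟩, hx0, hspan⟩ := finrank_eq_one_iff'.1 (finrank_supported_ker hχ hy)
  have hstable (r : ℕ) : ∀ g ∈ LinearMap.ker (aeval (rootMul χ) y),
      (rootMul χ ^ r) g ∈ LinearMap.ker (aeval (rootMul χ) y) := fun g hg => by
    rw [LinearMap.mem_ker, aeval_rootMul] at hg ⊢
    rw [rootMul_pow_apply, mul_left_comm, hg, mul_zero]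
  choose p hp using fun r => hspan ⟨_, dΓ_mem_supported (hstable r) hx⟩
  exact ⟨x, hx, p, fun h => hx0 (Subtype.ext h), fun r => (congrArg Subtype.val (hp r)).symm⟩

variable [IsAlgClosed K]

namespace IsJointEigenvector

theorem exists_dvd_eq_rootPsum (hχ : χ ≠ 0) (hx : IsJointEigenvector (rootMul χ) p x) :
    ∃ y : K[X], y.Monic ∧ y ∣ χ ∧ p = rootPsum y ∧
      x ∈ supported (LinearMap.ker (aeval (rootMul χ) y)) y.natDegree := by
  have := finiteDimensional_adjoinRoot hχ
  obtain ⟨y, hy, hp, hxy⟩ := hx.exists_eq_rootPsum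
  refine ⟨y, hy, dvd_of_mem_supported_ker hχ hy.ne_zero dvd_rfl hx.ne_zero ?_, hp, hxy⟩
  rwa [ker_aeval_rootMul_self, inf_top_eq]

theorem exists_eq_smul (hχ : χ ≠ 0) (hx : IsJointEigenvector (rootMul χ) p x)
    (hx' : IsJointEigenvector (rootMul χ) p x') : ∃ c : K, c • x = x' := by
  obtain ⟨y, hy, hdvd, rfl, hxy⟩ := hx.exists_dvd_eq_rootPsum hχ
  obtain ⟨y', hy', -, hp, hxy'⟩ := hx'.exists_dvd_eq_rootPsum hχ
  obtain rfl := eq_of_rootPsum_eq hy (IsAlgClosed.splits y) hy' (IsAlgClosed.splits y') hp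
  obtain ⟨c, hc⟩ := (finrank_eq_one_iff_of_nonzero' (⟨x, hxy⟩ : supported _ _)
    fun h => hx.ne_zero (congrArg Subtype.val h)).1 (finrank_supported_ker hχ hdvd) ⟨x', hxy'⟩
  exact ⟨c, congrArg Subtype.val hc⟩

end IsJointEigenvector

theorem exists_isJointEigenvector (hχ : χ ≠ 0) (hy : y.Monic) (hyχ : y ∣ χ) :
    ∃ x, IsJointEigenvector (rootMul χ) (rootPsum y) x := by
  obtain ⟨x, hxy, p, hx⟩ := exists_isJointEigenvector_mem_supported hχ hyχ
  obtain ⟨z, hz, hzχ, rfl, hxz⟩ := hx.exists_dvd_eq_rootPsum hχ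
  have hdeg : y.natDegree = z.natDegree := by
    have h := (dΓ_one_of_mem_exteriorPower (mem_supported.1 hxy).1).symm.trans (hx.apply 0)
    rw [rootPsum_zero (IsAlgClosed.splits z)] at h
    exact_mod_cast smul_left_injective K hx.ne_zero h
  have hyz : y ∣ z := dvd_of_mem_supported_ker hχ hy.ne_zero hzχ hx.ne_zero
    ((supported_inf _ _ y.natDegree).le ⟨hxy, hdeg.symm ▸ hxz⟩)
  obtain rfl := eq_of_monic_of_dvd_of_natDegree_le hy hz hyz hdeg.ge
  exact ⟨x, hx⟩

end Fock

@[elab_as_elim]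
theorem polynomial_linear_induction {R : Type*} [Semiring R] {P : R[X] → Prop} (p : R[X])
    (X_pow : ∀ r : ℕ, P (X ^ r)) (add : ∀ p q, P p → P q → P (p + q))
    (smul : ∀ (c : R) p, P p → P (c • p)) : P p := by
  induction p using Polynomial.induction_on' with
  | add p q hp hq => exact add p q hp hq
  | monomial r c => rw [← smul_X_eq_monomial]; exact smul c _ (X_pow r)

section RootSum

variable {K : Type*} [Field K]

/-- The sum of the values of a polynomial at the roots of `η`. -/
def rootSum (η : K[X]) : K[X] →ₗ[K] K where
  toFun p := (η.roots.map p.eval).sum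
  map_add' p q := by simp [Multiset.sum_map_add]
  map_smul' c p := by simp [Multiset.sum_map_mul_left]

theorem rootSum_apply (η p : K[X]) : rootSum η p = (η.roots.map p.eval).sum := rfl

theorem rootSum_X_pow (η : K[X]) (r : ℕ) : rootSum η (X ^ r) = rootPsum η r := by
  simp [rootSum_apply, rootPsum]

theorem rootSum_eq_zero_of_dvd {η p : K[X]} (h : η ∣ p) : rootSum η p = 0 := by
  refine Multiset.sum_eq_zero fun c hc => ?_
  obtain ⟨a, ha, rfl⟩ := Multiset.mem_map.1 hc
  exact (isRoot_of_mem_roots ha).dvd h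

theorem derivative_eq_sum_divByMonic {η : K[X]} (hη : η.Monic) (hs : η.Splits) :
    derivative η = (η.roots.map fun a => η /ₘ (X - C a)).sum := by
  classical
  have hprod : (η.roots.map fun a => X - C a).prod = η := (hs.eq_prod_roots_of_monic hη).symm
  conv_lhs => rw [← hprod, derivative_prod]
  refine congrArg Multiset.sum (Multiset.map_congr rfl fun a ha => ?_)
  rw [derivative_X_sub_C, mul_one,
    ← mul_divByMonic_cancel_left (Multiset.prod _) (monic_X_sub_C a),
    Multiset.prod_map_erase (f := fun a => X - C a) ha, hprod]

theorem rootSum_eq_coeff {η : K[X]} (hη : η.Monic) (hs : η.Splits) {p h : K[X]}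
    (hdvd : η ∣ p * derivative η - h) (hdeg : h.degree < η.degree) :
    rootSum η p = h.coeff (η.natDegree - 1) := by
  let H : K[X] := (η.roots.map fun a => C (p.eval a) * (η /ₘ (X - C a))).sum
  have hroot (a : K) (ha : a ∈ η.roots) : (X - C a) * (η /ₘ (X - C a)) = η :=
    mul_divByMonic_eq_iff_isRoot.2 (isRoot_of_mem_roots ha)
  have hηH : η ∣ p * derivative η - H := by
    rw [derivative_eq_sum_divByMonic hη hs, ← Multiset.sum_map_mul_left, ← Multiset.sum_map_sub]
    refine Multiset.dvd_sum fun q hq => ?_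
    obtain ⟨a, ha, rfl⟩ := Multiset.mem_map.1 hq
    obtain ⟨P, hP⟩ := X_sub_C_dvd_sub_C_eval (a := a) (p := p)
    refine ⟨P, ?_⟩
    linear_combination (η /ₘ (X - C a)) * hP + P * hroot a ha
  have hHdeg : H.degree < η.degree := by
    rw [degree_eq_natDegree hη.ne_zero, ← mem_degreeLT]
    refine multiset_sum_mem _ fun q hq => ?_
    obtain ⟨a, -, rfl⟩ := Multiset.mem_map.1 hq
    rw [← smul_eq_C_mul]
    refine Submodule.smul_mem _ _ (mem_degreeLT.2 ?_)
    rw [← degree_eq_natDegree hη.ne_zero]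
    exact degree_divByMonic_lt _ _ hη.ne_zero (by rw [degree_X_sub_C]; exact zero_lt_one)
  have hhH : h = H := by
    have hd : η ∣ h - H := by simpa only [sub_sub_sub_cancel_left] using dvd_sub hηH hdvd
    exact sub_eq_zero.1 (eq_zero_of_dvd_of_degree_lt hd
      ((degree_sub_le _ _).trans_lt (max_lt hdeg hHdeg)))
  have hcoeff : H.coeff (η.natDegree - 1) =
      (η.roots.map fun a => (C (p.eval a) * (η /ₘ (X - C a))).coeff (η.natDegree - 1)).sum := by
    rw [← lcoeff_apply, map_multiset_sum, Multiset.map_map]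
    rfl
  rw [hhH, hcoeff, rootSum_apply]
  refine congrArg Multiset.sum (Multiset.map_congr rfl fun a ha => ?_)
  have hmonic : (η /ₘ (X - C a)).Monic :=
    (monic_X_sub_C a).of_mul_monic_left ((hroot a ha).symm ▸ hη)
  have hnat : (η /ₘ (X - C a)).natDegree = η.natDegree - 1 := by
    rw [natDegree_divByMonic _ (monic_X_sub_C a), natDegree_X_sub_C]
  rw [coeff_C_mul, ← hnat, hmonic.coeff_natDegree, mul_one]

end RootSum

section Trace

variable {K : Type*} [Field K] {η : K[X]}

/-- A linear map on polynomials that vanishes on the multiples of `η`, as a map on `K[X]/(η)`;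
otherwise it is evaluated on the remainder modulo `η`. -/
def liftAdjoin {W : Type*} [AddCommGroup W] [Module K W] (hη : η.Monic) (f : K[X] →ₗ[K] W) :
    AdjoinRoot η →ₗ[K] W :=
  f ∘ₗ AdjoinRoot.modByMonicHom hη

theorem liftAdjoin_mk {W : Type*} [AddCommGroup W] [Module K W] (hη : η.Monic) {f : K[X] →ₗ[K] W}
    (hf : ∀ p, η ∣ p → f p = 0) (p : K[X]) : liftAdjoin hη f (AdjoinRoot.mk η p) = f p := by
  rw [liftAdjoin, LinearMap.comp_apply, AdjoinRoot.modByMonicHom_mk, ← sub_eq_zero, ← map_sub]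
  refine hf _ ⟨-(p /ₘ η), ?_⟩
  linear_combination modByMonic_add_div p η

/-- The linear form on `K[X]/(η)` given by the sum of the values at the roots of `η`. -/
def traceForm (hη : η.Monic) : Module.Dual K (AdjoinRoot η) := liftAdjoin hη (rootSum η)

theorem traceForm_mk (hη : η.Monic) (p : K[X]) :
    traceForm hη (AdjoinRoot.mk η p) = rootSum η p :=
  liftAdjoin_mk hη (fun _ h => rootSum_eq_zero_of_dvd h) p

theorem traceForm_root_pow (hη : η.Monic) (r : ℕ) :
    traceForm hη (AdjoinRoot.root η ^ r) = rootPsum η r := by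
  rw [← AdjoinRoot.mk_X, ← map_pow, traceForm_mk, rootSum_X_pow]

theorem traceForm_one [IsAlgClosed K] (hη : η.Monic) : traceForm hη 1 = η.natDegree := by
  rw [← pow_zero (AdjoinRoot.root η), traceForm_root_pow, rootPsum_zero (IsAlgClosed.splits η)]

theorem traceForm_ne_zero [IsAlgClosed K] [CharZero K] (hη : η.Monic) (hN : η.natDegree ≠ 0) :
    traceForm hη ≠ 0 := fun h =>
  Nat.cast_ne_zero.2 hN ((traceForm_one hη).symm.trans (LinearMap.congr_fun h 1))

theorem add_divByMonic {q : K[X]} (hq : q.Monic) (f g : K[X]) :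
    (f + g) /ₘ q = f /ₘ q + g /ₘ q := by
  refine (div_modByMonic_unique _ (f %ₘ q + g %ₘ q) hq ⟨?_, ?_⟩).1
  · linear_combination modByMonic_add_div f q + modByMonic_add_div g q
  · exact (degree_add_le _ _).trans_lt
      (max_lt (degree_modByMonic_lt _ hq) (degree_modByMonic_lt _ hq))

theorem smul_divByMonic {q : K[X]} (hq : q.Monic) (c : K) (f : K[X]) :
    (c • f) /ₘ q = c • (f /ₘ q) := by
  refine (div_modByMonic_unique _ (c • (f %ₘ q)) hq ⟨?_, ?_⟩).1
  · rw [mul_smul_comm, ← smul_add, modByMonic_add_div]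
  · exact (degree_smul_le _ _).trans_lt (degree_modByMonic_lt _ hq)

end Trace

section MonicDeriv

variable {K : Type*} [Field K] {η : K[X]}

/-- The derivative of `η`, made monic. -/
def monicDeriv (η : K[X]) : K[X] := (η.natDegree : K)⁻¹ • derivative η

theorem natDegree_monicDeriv_le : (monicDeriv η).natDegree ≤ η.natDegree - 1 :=
  (natDegree_smul_le _ _).trans (natDegree_derivative_le η)

variable [CharZero K]

theorem derivative_eq_smul_monicDeriv (hN : η.natDegree ≠ 0) :
    derivative η = (η.natDegree : K) • monicDeriv η := by
  rw [monicDeriv, smul_inv_smul₀ (Nat.cast_ne_zero.2 hN)]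

theorem dvd_monicDeriv_iff (hN : η.natDegree ≠ 0) {y : K[X]} :
    y ∣ monicDeriv η ↔ y ∣ derivative η := by
  rw [derivative_eq_smul_monicDeriv hN, smul_eq_C_mul,
    (isUnit_C.2 (Nat.cast_ne_zero.2 hN).isUnit).dvd_mul_left]

theorem coeff_monicDeriv (hη : η.Monic) (hN : η.natDegree ≠ 0) :
    (monicDeriv η).coeff (η.natDegree - 1) = 1 := by
  rw [monicDeriv, coeff_smul, coeff_derivative, Nat.sub_add_cancel (Nat.pos_of_ne_zero hN),
    hη.coeff_natDegree, one_mul, smul_eq_mul, ← Nat.cast_succ, Nat.succ_eq_add_one,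
    Nat.sub_add_cancel (Nat.pos_of_ne_zero hN), inv_mul_cancel₀ (Nat.cast_ne_zero.2 hN)]

theorem monic_monicDeriv (hη : η.Monic) (hN : η.natDegree ≠ 0) : (monicDeriv η).Monic :=
  monic_of_natDegree_le_of_coeff_eq_one _ natDegree_monicDeriv_le (coeff_monicDeriv hη hN)

theorem natDegree_monicDeriv (hη : η.Monic) (hN : η.natDegree ≠ 0) :
    (monicDeriv η).natDegree = η.natDegree - 1 :=
  natDegree_monicDeriv_le.antisymm
    (le_natDegree_of_ne_zero ((coeff_monicDeriv hη hN).symm ▸ one_ne_zero))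

end MonicDeriv

section DerivEmb

variable {K : Type*} [Field K] [CharZero K] {η : K[X]} (hη : η.Monic) (hN : η.natDegree ≠ 0)

/-- The map `g ↦ [g η / η']` from `K[X]/(η')` to `K[X]/(η)`, where `[ ]` is the polynomial part of
a rational function; it parametrizes the kernel of the trace form. -/
def derivEmb : AdjoinRoot (monicDeriv η) →ₗ[K] AdjoinRoot η :=
  liftAdjoin (monic_monicDeriv hη hN)
    { toFun g := AdjoinRoot.mk η ((g * η) /ₘ monicDeriv η)
      map_add' f g := by rw [add_mul, add_divByMonic (monic_monicDeriv hη hN), map_add]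
      map_smul' c g := by
        rw [smul_mul_assoc, smul_divByMonic (monic_monicDeriv hη hN), AdjoinRoot.smul_mk]; rfl }

theorem derivEmb_mk (g : K[X]) : derivEmb hη hN (AdjoinRoot.mk _ g) =
    AdjoinRoot.mk η ((g * η) /ₘ monicDeriv η) := by
  refine liftAdjoin_mk _ ?_ g
  rintro _ ⟨h, rfl⟩
  simp only [LinearMap.coe_mk, AddHom.coe_mk, mul_assoc,
    mul_divByMonic_cancel_left _ (monic_monicDeriv hη hN), map_mul, AdjoinRoot.mk_self, mul_zero]

theorem traceForm_derivEmb [IsAlgClosed K] (g : AdjoinRoot (monicDeriv η)) :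
    traceForm hη (derivEmb hη hN g) = 0 := by
  obtain ⟨g, rfl⟩ := AdjoinRoot.mk_surjective g
  have hχ := monic_monicDeriv hη hN
  let r : K[X] := (g * η) %ₘ monicDeriv η
  have hlt : r.degree < ((η.natDegree - 1 : ℕ) : WithBot ℕ) := by
    refine (degree_modByMonic_lt _ hχ).trans_le ?_
    rw [degree_eq_natDegree hχ.ne_zero, natDegree_monicDeriv hη hN]
  have hlt' : ((-(η.natDegree : K)) • r).degree < ((η.natDegree - 1 : ℕ) : WithBot ℕ) :=
    (degree_smul_le _ _).trans_lt hlt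
  rw [derivEmb_mk, traceForm_mk, rootSum_eq_coeff hη (IsAlgClosed.splits η)
    (h := (-(η.natDegree : K)) • r) ?_ ?_, coeff_eq_zero_of_degree_lt hlt']
  · refine ⟨(η.natDegree : K) • g, ?_⟩
    rw [derivative_eq_smul_monicDeriv hN, smul_eq_C_mul, smul_eq_C_mul, smul_eq_C_mul, C_neg]
    linear_combination C (η.natDegree : K) * modByMonic_add_div (g * η) (monicDeriv η)
  · refine hlt'.trans_le ?_
    rw [degree_eq_natDegree hη.ne_zero]
    exact_mod_cast Nat.sub_le _ _

theorem derivEmb_injective : Function.Injective (derivEmb hη hN) := by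
  refine (injective_iff_map_eq_zero _).2 fun g hg => ?_
  obtain ⟨g, rfl⟩ := AdjoinRoot.mk_surjective g
  have hχ := monic_monicDeriv hη hN
  rw [derivEmb_mk, AdjoinRoot.mk_eq_zero] at hg
  obtain ⟨q, hq⟩ := hg
  have hdvd : η ∣ (g * η) %ₘ monicDeriv η := by
    refine ⟨g - monicDeriv η * q, ?_⟩
    linear_combination modByMonic_add_div (g * η) (monicDeriv η) - monicDeriv η * hq
  have hdeg : ((g * η) %ₘ monicDeriv η).degree < η.degree := by
    refine (degree_modByMonic_lt _ hχ).trans_le ?_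
    rw [degree_eq_natDegree hχ.ne_zero, natDegree_monicDeriv hη hN,
      degree_eq_natDegree hη.ne_zero]
    exact_mod_cast Nat.sub_le _ _
  have hmod := modByMonic_add_div (g * η) (monicDeriv η)
  rw [eq_zero_of_dvd_of_degree_lt hdvd hdeg, hq, zero_add] at hmod
  rw [AdjoinRoot.mk_eq_zero]
  exact ⟨q, mul_right_cancel₀ hη.ne_zero (by linear_combination -hmod)⟩

theorem derivEmb_root_mul (g : AdjoinRoot (monicDeriv η)) : ∃ c : K,
    derivEmb hη hN (rootMul _ g) =
      AdjoinRoot.root η * derivEmb hη hN g + c • (1 : AdjoinRoot η) := by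
  obtain ⟨g, rfl⟩ := AdjoinRoot.mk_surjective g
  have hχ := monic_monicDeriv hη hN
  let q : K[X] := (g * η) /ₘ monicDeriv η
  let r : K[X] := (g * η) %ₘ monicDeriv η
  have hdiv : r + monicDeriv η * q = g * η := modByMonic_add_div (g * η) (monicDeriv η)
  obtain ⟨c, hc⟩ : ∃ c, (X * r) /ₘ monicDeriv η = C c := by
    refine ⟨_, eq_C_of_natDegree_eq_zero ?_⟩
    rw [natDegree_divByMonic _ hχ]
    rcases eq_or_ne r 0 with h0 | h0
    · simp [h0]
    · have := natDegree_lt_natDegree h0 (degree_modByMonic_lt (g * η) hχ)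
      rw [natDegree_X_mul h0]
      omega
  have hquot : (X * g * η) /ₘ monicDeriv η = X * q + C c := by
    rw [mul_assoc, ← hdiv, mul_add, mul_left_comm, add_divByMonic hχ, hc,
      mul_divByMonic_cancel_left _ hχ, add_comm]
  refine ⟨c, ?_⟩
  have hX : rootMul (monicDeriv η) (AdjoinRoot.mk _ g) = AdjoinRoot.mk _ (X * g) := by
    rw [map_mul, AdjoinRoot.mk_X]; rfl
  rw [hX, derivEmb_mk, derivEmb_mk, hquot, map_add, map_mul,
    AdjoinRoot.mk_X, AdjoinRoot.mk_C, Algebra.smul_def, mul_one]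
  rfl

theorem range_derivEmb [IsAlgClosed K] :
    LinearMap.range (derivEmb hη hN) = LinearMap.ker (traceForm hη) := by
  have := finiteDimensional_adjoinRoot hη.ne_zero
  refine Submodule.eq_of_le_of_finrank_le ?_ ?_
  · rintro _ ⟨g, rfl⟩
    exact traceForm_derivEmb hη hN g
  · have hker := Module.Dual.finrank_ker_add_one_of_ne_zero (traceForm_ne_zero hη hN)
    rw [finrank_adjoinRoot hη.ne_zero] at hker
    rw [LinearMap.finrank_range_of_inj (derivEmb_injective hη hN),
      finrank_adjoinRoot (monic_monicDeriv hη hN).ne_zero, natDegree_monicDeriv hη hN]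
    omega

end DerivEmb

namespace Fock

variable {K V W : Type*} [Field K] [AddCommGroup V] [Module K V] [AddCommGroup W] [Module K W]

theorem range_map_eq_ker_contract {φ : Module.Dual K V} (hφ : φ ≠ 0) {f : W →ₗ[K] V}
    (hf : LinearMap.range f = LinearMap.ker φ) :
    LinearMap.range (ExteriorAlgebra.map f).toLinearMap = LinearMap.ker (contract φ) := by
  refine le_antisymm ?_ fun x hx => ?_
  · rintro _ ⟨x, rfl⟩
    rw [LinearMap.mem_ker, AlgHom.toLinearMap_apply, contract_map,
      LinearMap.range_le_ker_iff.1 hf.le, map_zero, LinearMap.zero_apply, map_zero]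
  · obtain ⟨u, hu⟩ := LinearMap.surjective hφ 1
    obtain ⟨g, hg⟩ := f.rangeRestrict.exists_rightInverse_of_surjective f.range_rangeRestrict
    let π : V →ₗ[K] V := LinearMap.id - φ.smulRight u
    have hπ (v : V) : π v ∈ LinearMap.range f := by
      rw [hf, LinearMap.mem_ker]
      simp [π, hu]
    have hfg : f ∘ₗ g ∘ₗ π.codRestrict _ hπ = π :=
      LinearMap.ext fun v => congrArg Subtype.val (LinearMap.congr_fun hg _)
    refine ⟨ExteriorAlgebra.map (g ∘ₗ π.codRestrict _ hπ) x, ?_⟩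
    rw [AlgHom.toLinearMap_apply, ← AlgHom.comp_apply, ExteriorAlgebra.map_comp_map, hfg,
      map_id_sub_smulRight, LinearMap.mem_ker.1 hx, mul_zero, sub_zero]

end Fock

section Gaudin

variable {K : Type*} [Field K] {η : K[X]} (hη : η.Monic)

/-- The coefficients of `v ↦ tr(v/(x-t))/(x-t) - ζ(x) v/(x-t)` on `K[t]/(η)`, where
`ζ = η'/η`. -/
def gaudinOp (m : ℕ) : Module.End K (AdjoinRoot η) :=
  ∑ p ∈ Finset.HasAntidiagonal.antidiagonal m,
    ((traceForm hη ∘ₗ rootMul η ^ p.2).smulRight (AdjoinRoot.root η ^ p.1) -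
      rootPsum η p.1 • rootMul η ^ p.2)

theorem gaudinOp_apply (m : ℕ) (v : AdjoinRoot η) : gaudinOp hη m v =
    ∑ p ∈ Finset.HasAntidiagonal.antidiagonal m,
        traceForm hη (AdjoinRoot.root η ^ p.2 * v) • AdjoinRoot.root η ^ p.1 -
      ∑ p ∈ Finset.HasAntidiagonal.antidiagonal m,
        rootPsum η p.1 • (AdjoinRoot.root η ^ p.2 * v) := by
  simp only [gaudinOp, LinearMap.sum_apply, ← Finset.sum_sub_distrib, LinearMap.sub_apply,
    LinearMap.smulRight_apply, LinearMap.comp_apply, LinearMap.smul_apply, rootMul_pow_apply]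

theorem traceForm_gaudinOp (m : ℕ) (v : AdjoinRoot η) : traceForm hη (gaudinOp hη m v) = 0 := by
  rw [gaudinOp_apply, map_sub, map_sum, map_sum, sub_eq_zero]
  refine Finset.sum_congr rfl fun p _ => ?_
  rw [map_smul, map_smul, traceForm_root_pow, smul_eq_mul, smul_eq_mul, mul_comm]

theorem gaudinOp_succ (m : ℕ) (v : AdjoinRoot η) : gaudinOp hη (m + 1) v =
    AdjoinRoot.root η * gaudinOp hη m v +
      traceForm hη (AdjoinRoot.root η ^ (m + 1) * v) • (1 : AdjoinRoot η) -
      rootPsum η (m + 1) • v := by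
  rw [gaudinOp_apply, gaudinOp_apply, Finset.Nat.sum_antidiagonal_succ,
    Finset.Nat.sum_antidiagonal_succ', mul_sub, Finset.mul_sum, Finset.mul_sum]
  simp only [pow_succ', mul_smul_comm, pow_zero, one_mul, mul_assoc]
  abel

/-- The operator on `K[t]/(η')` that `gaudinOp` induces on the kernel of the trace form: minus the
coefficients of the multiplication by `ζ(x)/(x-t)`. -/
def singGaudinOp (η : K[X]) (m : ℕ) : Module.End K (AdjoinRoot (monicDeriv η)) :=
  -∑ p ∈ Finset.HasAntidiagonal.antidiagonal m, rootPsum η p.1 • rootMul (monicDeriv η) ^ p.2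

theorem singGaudinOp_succ (m : ℕ) : singGaudinOp η (m + 1) =
    rootMul (monicDeriv η) * singGaudinOp η m - rootPsum η (m + 1) • 1 := by
  ext1 g
  simp only [singGaudinOp, Finset.Nat.sum_antidiagonal_succ', LinearMap.neg_apply,
    LinearMap.add_apply, LinearMap.sub_apply, LinearMap.sum_apply, LinearMap.smul_apply,
    Module.End.mul_apply, map_neg, map_sum, map_smul, pow_succ', pow_zero]
  abel

variable [CharZero K] [IsAlgClosed K] (hN : η.natDegree ≠ 0)

theorem gaudinOp_derivEmb (m : ℕ) (g : AdjoinRoot (monicDeriv η)) :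
    gaudinOp hη m (derivEmb hη hN g) = derivEmb hη hN (singGaudinOp η m g) := by
  induction m with
  | zero => simp [gaudinOp_apply, singGaudinOp, traceForm_derivEmb]
  | succ m ih =>
    obtain ⟨c, hc⟩ := derivEmb_root_mul hη hN (singGaudinOp η m g)
    obtain ⟨d, hd⟩ : ∃ d : K, gaudinOp hη (m + 1) (derivEmb hη hN g) =
        derivEmb hη hN (singGaudinOp η (m + 1) g) + d • (1 : AdjoinRoot η) := by
      refine ⟨traceForm hη (AdjoinRoot.root η ^ (m + 1) * derivEmb hη hN g) - c, ?_⟩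
      rw [gaudinOp_succ, ih, singGaudinOp_succ, LinearMap.sub_apply, Module.End.mul_apply,
        map_sub, hc, LinearMap.smul_apply, Module.End.one_apply, map_smul]
      module
    have htr := congrArg (traceForm hη) hd
    rw [traceForm_gaudinOp, map_add, traceForm_derivEmb, zero_add, map_smul, traceForm_one,
      smul_eq_mul, zero_eq_mul, or_iff_left (Nat.cast_ne_zero.2 hN)] at htr
    rw [hd, htr, zero_smul, add_zero]

end Gaudin

namespace CurrentRep

section LowSpan

variable {M : Type*} [AddCommGroup M] [Module ℂ M] (ρ : CurrentRep M)

/-- The action of `e_{21} ⊗ p(t)`. -/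
def low : ℂ[X] →ₗ[ℂ] Module.End ℂ M := (Polynomial.basisMonomials ℂ).constr ℂ (ρ.e 1 0)

theorem low_X_pow (r : ℕ) : ρ.low (X ^ r) = ρ.e 1 0 r := by
  have h := (Polynomial.basisMonomials ℂ).constr_basis ℂ (ρ.e 1 0) r
  rw [coe_basisMonomials] at h
  rw [← monomial_one_right_eq_X_pow]
  exact h

theorem low_eq_sum (p : ℂ[X]) :
    ρ.low p = ∑ i ∈ Finset.range (p.natDegree + 1), p.coeff i • ρ.e 1 0 i := by
  conv_lhs => rw [p.as_sum_range]
  rw [map_sum]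
  refine Finset.sum_congr rfl fun i _ => ?_
  rw [← smul_X_eq_monomial, map_smul, low_X_pow]

theorem e10_anticomm (r s : ℕ) : ρ.e 1 0 r * ρ.e 1 0 s = -(ρ.e 1 0 s * ρ.e 1 0 r) :=
  eq_neg_of_add_eq_zero_left (by simpa [par] using ρ.bracket 1 0 1 0 r s)

theorem e11_e10 (r s : ℕ) :
    ρ.e 1 1 r * ρ.e 1 0 s = ρ.e 1 0 (r + s) + ρ.e 1 0 s * ρ.e 1 1 r :=
  sub_eq_iff_eq_add.1 (by simpa [par] using ρ.bracket 1 1 1 0 r s)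

theorem e00_e10 (r s : ℕ) :
    ρ.e 0 0 r * ρ.e 1 0 s = -ρ.e 1 0 (r + s) + ρ.e 1 0 s * ρ.e 0 0 r :=
  sub_eq_iff_eq_add.1 (by simpa [par] using ρ.bracket 0 0 1 0 r s)

theorem e01_e10 (r s : ℕ) : ρ.e 0 1 r * ρ.e 1 0 s =
    ρ.e 0 0 (r + s) + ρ.e 1 1 (r + s) - ρ.e 1 0 s * ρ.e 0 1 r :=
  eq_sub_of_add_eq (by simpa [par] using ρ.bracket 0 1 1 0 r s)

theorem low_anticomm (p q : ℂ[X]) : ρ.low p * ρ.low q = -(ρ.low q * ρ.low p) := by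
  induction p using polynomial_linear_induction with
  | add p p' hp hp' => rw [map_add, add_mul, mul_add, hp, hp', neg_add]
  | smul c p hp => rw [map_smul, smul_mul_assoc, mul_smul_comm, hp, smul_neg]
  | X_pow r =>
    induction q using polynomial_linear_induction with
    | add p p' hp hp' => rw [map_add, add_mul, mul_add, hp, hp', neg_add]
    | smul c p hp => rw [map_smul, smul_mul_assoc, mul_smul_comm, hp, smul_neg]
    | X_pow s => rw [low_X_pow, low_X_pow, e10_anticomm]

theorem low_mul_self (p : ℂ[X]) : ρ.low p * ρ.low p = 0 := by
  have h := eq_neg_iff_add_eq_zero.1 (ρ.low_anticomm p p)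
  rw [← two_smul ℂ] at h
  exact (smul_eq_zero.1 h).resolve_left two_ne_zero

theorem e11_low (r : ℕ) (p : ℂ[X]) :
    ρ.e 1 1 r * ρ.low p = ρ.low (X ^ r * p) + ρ.low p * ρ.e 1 1 r := by
  induction p using polynomial_linear_induction with
  | add p q hp hq => rw [mul_add, map_add, map_add, mul_add, hp, hq, add_mul]; abel
  | smul c p hp =>
    rw [mul_smul_comm, map_smul, map_smul, mul_smul_comm, hp, smul_mul_assoc, smul_add]
  | X_pow s => rw [← pow_add, low_X_pow, low_X_pow, e11_e10]

/-- The action of the central element `(e_{11} + e_{22})[r]`. -/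
def cent (r : ℕ) : Module.End ℂ M := ρ.e 0 0 r + ρ.e 1 1 r

theorem cent_low (r : ℕ) (p : ℂ[X]) : ρ.cent r * ρ.low p = ρ.low p * ρ.cent r := by
  induction p using polynomial_linear_induction with
  | add p q hp hq => rw [map_add, mul_add, hp, hq, add_mul]
  | smul c p hp => rw [map_smul, mul_smul_comm, hp, smul_mul_assoc]
  | X_pow s => rw [low_X_pow, cent, add_mul, e00_e10, e11_e10, mul_add]; abel

/-- The smallest subspace that contains `w` and is stable under `e_{21}[r]`, `r ≥ 0`. -/
def lowSpan (w : M) : Submodule ℂ M :=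
  sInf {N : Submodule ℂ M | w ∈ N ∧ ∀ p, ∀ v ∈ N, ρ.low p v ∈ N}

theorem lowSpan_le {w : M} {N : Submodule ℂ M} (hw : w ∈ N) (h : ∀ p, ∀ v ∈ N, ρ.low p v ∈ N) :
    ρ.lowSpan w ≤ N := sInf_le ⟨hw, h⟩

theorem mem_lowSpan (w : M) : w ∈ ρ.lowSpan w :=
  Submodule.mem_sInf.2 fun _ hN => hN.1

theorem low_mem_lowSpan {w v : M} (hv : v ∈ ρ.lowSpan w) (p : ℂ[X]) :
    ρ.low p v ∈ ρ.lowSpan w :=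
  Submodule.mem_sInf.2 fun N hN => hN.2 p v (Submodule.mem_sInf.1 hv N hN)

theorem map_mem_lowSpan {w : M} {S : Module.End ℂ M} (hw : S w ∈ ρ.lowSpan w)
    (h : ∀ p, ∀ v ∈ ρ.lowSpan w, S v ∈ ρ.lowSpan w → S (ρ.low p v) ∈ ρ.lowSpan w) {v : M}
    (hv : v ∈ ρ.lowSpan w) : S v ∈ ρ.lowSpan w := by
  have hle : ρ.lowSpan w ≤ ρ.lowSpan w ⊓ (ρ.lowSpan w).comap S :=
    ρ.lowSpan_le ⟨ρ.mem_lowSpan w, hw⟩ fun p v hv =>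
      ⟨ρ.low_mem_lowSpan hv.1 p, h p v hv.1 hv.2⟩
  exact (hle hv).2

/-- `w` satisfies the defining relations of the module `W_η` for a monic polynomial `η`; for
`η = (t - b) ^ m` this is the Weyl module `W_m(b)`, where `e_{11}[r] w = m b ^ r w`. -/
structure IsWeylVector (η : ℂ[X]) (w : M) : Prop where
  e00 : ∀ r, ρ.e 0 0 r w = rootPsum η r • w
  e11 : ∀ r, ρ.e 1 1 r w = 0
  e01 : ∀ r, ρ.e 0 1 r w = 0
  low : ρ.low η w = 0

namespace IsWeylVector

variable {ρ} {η : ℂ[X]} {w : M}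

theorem cent_apply_of_mem (h : ρ.IsWeylVector η w) {v : M} (hv : v ∈ ρ.lowSpan w) (r : ℕ) :
    ρ.cent r v = rootPsum η r • v := by
  have hle : ρ.lowSpan w ≤ LinearMap.eqLocus (ρ.cent r) (rootPsum η r • 1) := by
    refine ρ.lowSpan_le ?_ fun p v hv => ?_
    · simp [cent, h.e00, h.e11]
    · rw [LinearMap.mem_eqLocus] at hv ⊢
      rw [← Module.End.mul_apply, ρ.cent_low, Module.End.mul_apply, hv, LinearMap.smul_apply,
        Module.End.one_apply, map_smul, LinearMap.smul_apply, Module.End.one_apply]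
  exact hle hv

theorem e11_mem (h : ρ.IsWeylVector η w) {v : M} (hv : v ∈ ρ.lowSpan w) (r : ℕ) :
    ρ.e 1 1 r v ∈ ρ.lowSpan w := by
  refine ρ.map_mem_lowSpan (by rw [h.e11]; exact zero_mem _) (fun p v hv hv' => ?_) hv
  rw [← Module.End.mul_apply, e11_low]
  exact add_mem (ρ.low_mem_lowSpan hv _) (ρ.low_mem_lowSpan hv' _)

theorem e00_mem (h : ρ.IsWeylVector η w) {v : M} (hv : v ∈ ρ.lowSpan w) (r : ℕ) :
    ρ.e 0 0 r v ∈ ρ.lowSpan w := by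
  rw [eq_sub_of_add_eq (h.cent_apply_of_mem hv r)]
  exact sub_mem (Submodule.smul_mem _ _ hv) (h.e11_mem hv r)

theorem e01_low_apply_of_mem (h : ρ.IsWeylVector η w) {v : M} (hv : v ∈ ρ.lowSpan w)
    (r : ℕ) (p : ℂ[X]) : ρ.e 0 1 r (ρ.low p v) =
      rootSum η (X ^ r * p) • v - ρ.low p (ρ.e 0 1 r v) := by
  induction p using polynomial_linear_induction with
  | add p q hp hq =>
    simp only [map_add, LinearMap.add_apply, mul_add, add_smul, hp, hq]; abel
  | smul c p hp =>
    simp only [map_smul, LinearMap.smul_apply, mul_smul_comm, hp, smul_sub, smul_assoc]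
  | X_pow s =>
    rw [low_X_pow, ← Module.End.mul_apply, e01_e10, ← cent, LinearMap.sub_apply,
      h.cent_apply_of_mem hv, Module.End.mul_apply, ← pow_add, rootSum_X_pow]

theorem e01_mem (h : ρ.IsWeylVector η w) {v : M} (hv : v ∈ ρ.lowSpan w) (r : ℕ) :
    ρ.e 0 1 r v ∈ ρ.lowSpan w := by
  refine ρ.map_mem_lowSpan (by rw [h.e01]; exact zero_mem _) (fun p v hv hv' => ?_) hv
  rw [h.e01_low_apply_of_mem hv]
  exact sub_mem (Submodule.smul_mem _ _ hv) (ρ.low_mem_lowSpan hv' _)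

theorem e_mem (h : ρ.IsWeylVector η w) {v : M} (hv : v ∈ ρ.lowSpan w) (i j : Fin 2) (r : ℕ) :
    ρ.e i j r v ∈ ρ.lowSpan w := by
  fin_cases i <;> fin_cases j
  · exact h.e00_mem hv r
  · exact h.e01_mem hv r
  · exact low_X_pow ρ r ▸ ρ.low_mem_lowSpan hv (X ^ r)
  · exact h.e11_mem hv r

theorem low_apply_eq_zero_of_dvd (h : ρ.IsWeylVector η w) {p : ℂ[X]} (hp : η ∣ p) :
    ρ.low p w = 0 := by
  obtain ⟨q, rfl⟩ := hp
  rw [mul_comm]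
  induction q using polynomial_linear_induction with
  | add p q hp hq => rw [add_mul, map_add, LinearMap.add_apply, hp, hq, add_zero]
  | smul c p hp => rw [smul_mul_assoc, map_smul, LinearMap.smul_apply, hp, smul_zero]
  | X_pow r =>
    have := LinearMap.congr_fun (ρ.e11_low r η) w
    simpa [h.low, h.e11] using this.symm

theorem low_eq_zero_of_dvd (h : ρ.IsWeylVector η w) (hgen : ρ.lowSpan w = ⊤) {p : ℂ[X]}
    (hp : η ∣ p) : ρ.low p = 0 := by
  have hle : ρ.lowSpan w ≤ LinearMap.ker (ρ.low p) := by
    refine ρ.lowSpan_le (h.low_apply_eq_zero_of_dvd hp) fun q v hv => ?_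
    have := LinearMap.congr_fun (ρ.low_anticomm p q) v
    rw [LinearMap.mem_ker] at hv
    rw [LinearMap.mem_ker]
    simpa [hv] using this
  rw [hgen, top_le_iff] at hle
  exact LinearMap.ker_eq_top.1 hle

theorem cent_eq (h : ρ.IsWeylVector η w) (hgen : ρ.lowSpan w = ⊤) (r : ℕ) :
    ρ.cent r = rootPsum η r • 1 :=
  LinearMap.ext fun v => h.cent_apply_of_mem (hgen ▸ Submodule.mem_top : v ∈ ρ.lowSpan w) r

theorem e01_low_apply (h : ρ.IsWeylVector η w) (hgen : ρ.lowSpan w = ⊤) (v : M) (r : ℕ)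
    (p : ℂ[X]) : ρ.e 0 1 r (ρ.low p v) = rootSum η (X ^ r * p) • v - ρ.low p (ρ.e 0 1 r v) :=
  h.e01_low_apply_of_mem (hgen ▸ Submodule.mem_top : v ∈ ρ.lowSpan w) r p

end IsWeylVector

section FockMap

variable {η : ℂ[X]} (hη : η.Monic)

theorem liftAdjoin_low_mul_self (v : AdjoinRoot η) :
    liftAdjoin hη ρ.low v * liftAdjoin hη ρ.low v = 0 := ρ.low_mul_self _

/-- The action of the exterior algebra of `ℂ[X]/(η)` through `e_{21}`. -/
def wedgeAct : ExteriorAlgebra ℂ (AdjoinRoot η) →ₐ[ℂ] Module.End ℂ M :=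
  ExteriorAlgebra.lift ℂ ⟨liftAdjoin hη ρ.low, ρ.liftAdjoin_low_mul_self hη⟩

/-- The map `x ↦ x w` from the exterior algebra of `ℂ[X]/(η)`, the fermionic Fock space model of
the module generated by `w`. -/
def fockMap (w : M) : ExteriorAlgebra ℂ (AdjoinRoot η) →ₗ[ℂ] M :=
  (LinearMap.applyₗ w : Module.End ℂ M →ₗ[ℂ] M) ∘ₗ (ρ.wedgeAct hη).toLinearMap

theorem fockMap_one (w : M) : ρ.fockMap hη w 1 = w := by
  simp [fockMap]

end FockMap

namespace IsWeylVector

variable {ρ} {η : ℂ[X]} {w : M}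

theorem fockMap_ι_mul (h : ρ.IsWeylVector η w) (hgen : ρ.lowSpan w = ⊤)
    (hη : η.Monic) (p : ℂ[X]) (x : ExteriorAlgebra ℂ (AdjoinRoot η)) :
    ρ.fockMap hη w (ExteriorAlgebra.ι ℂ (AdjoinRoot.mk η p) * x) =
      ρ.low p (ρ.fockMap hη w x) := by
  have : ρ.wedgeAct hη (ExteriorAlgebra.ι ℂ (AdjoinRoot.mk η p)) = ρ.low p := by
    rw [wedgeAct, ExteriorAlgebra.lift_ι_apply]
    exact liftAdjoin_mk hη (fun p hp => h.low_eq_zero_of_dvd hgen hp) p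
  simp [fockMap, this]

theorem fockMap_surjective (h : ρ.IsWeylVector η w) (hgen : ρ.lowSpan w = ⊤)
    (hη : η.Monic) : Function.Surjective (ρ.fockMap hη w) := by
  rw [← LinearMap.range_eq_top, ← top_le_iff, ← hgen]
  refine ρ.lowSpan_le ⟨1, ρ.fockMap_one hη w⟩ ?_
  rintro p _ ⟨x, rfl⟩
  exact ⟨_, h.fockMap_ι_mul hgen hη p x⟩

theorem fockMap_contract (h : ρ.IsWeylVector η w) (hgen : ρ.lowSpan w = ⊤)
    (hη : η.Monic) (r : ℕ) (x : ExteriorAlgebra ℂ (AdjoinRoot η)) :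
    ρ.fockMap hη w (Fock.contract (traceForm hη ∘ₗ rootMul η ^ r) x) =
      ρ.e 0 1 r (ρ.fockMap hη w x) := by
  refine LinearMap.congr_fun
    (f := ρ.fockMap hη w ∘ₗ Fock.contract (traceForm hη ∘ₗ rootMul η ^ r))
    (g := ρ.e 0 1 r ∘ₗ ρ.fockMap hη w) (Fock.linearMap_ext ?_ fun v x hx => ?_) x
  · simp [fockMap_one, h.e01]
  · obtain ⟨p, rfl⟩ := AdjoinRoot.mk_surjective v
    have htrace : (traceForm hη ∘ₗ rootMul η ^ r) (AdjoinRoot.mk η p) = rootSum η (X ^ r * p) := by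
      rw [LinearMap.comp_apply, rootMul_pow_apply, ← AdjoinRoot.mk_X, ← map_pow, ← map_mul,
        traceForm_mk]
    simp only [LinearMap.comp_apply] at hx ⊢
    rw [Fock.contract_ι_mul, htrace, map_sub, map_smul, h.fockMap_ι_mul hgen,
      h.fockMap_ι_mul hgen, hx, h.e01_low_apply hgen]

theorem fockMap_dΓ (h : ρ.IsWeylVector η w) (hgen : ρ.lowSpan w = ⊤)
    (hη : η.Monic) (r : ℕ) (x : ExteriorAlgebra ℂ (AdjoinRoot η)) :
    ρ.fockMap hη w (Fock.dΓ (rootMul η ^ r) x) = ρ.e 1 1 r (ρ.fockMap hη w x) := by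
  refine LinearMap.congr_fun (f := ρ.fockMap hη w ∘ₗ Fock.dΓ (rootMul η ^ r))
    (g := ρ.e 1 1 r ∘ₗ ρ.fockMap hη w) (Fock.linearMap_ext ?_ fun v x hx => ?_) x
  · simp [fockMap_one, h.e11]
  · obtain ⟨p, rfl⟩ := AdjoinRoot.mk_surjective v
    simp only [LinearMap.comp_apply] at hx ⊢
    rw [Fock.dΓ_ι_mul, map_add, h.fockMap_ι_mul hgen, hx, rootMul_pow_apply, ← AdjoinRoot.mk_X,
      ← map_pow, ← map_mul, h.fockMap_ι_mul hgen, h.fockMap_ι_mul hgen, ← Module.End.mul_apply,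
      ← Module.End.mul_apply, e11_low, LinearMap.add_apply]

end IsWeylVector

end LowSpan

end CurrentRep

/-- The series `∑_r c_r x^{-r-1}`, where `x⁻¹` is the variable of `ℂ⸨X⸩`. -/
def serL (c : ℕ → ℂ) : ℂ⸨X⸩ :=
  HahnSeries.single 1 1 * HahnSeries.ofPowerSeries ℤ ℂ (PowerSeries.mk c)

theorem coeff_single_mul_ofPowerSeries (k : ℤ) (F : PowerSeries ℂ) (r : ℕ) :
    ((HahnSeries.single k 1 : ℂ⸨X⸩) * HahnSeries.ofPowerSeries ℤ ℂ F).coeff (r + k) =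
      PowerSeries.coeff r F := by
  rw [HahnSeries.coeff_single_mul_add, one_mul, HahnSeries.ofPowerSeries_apply_coeff]

theorem coeff_single_mul_ofPowerSeries_of_lt (k : ℤ) (F : PowerSeries ℂ) {i : ℤ} (hi : i < k) :
    ((HahnSeries.single k 1 : ℂ⸨X⸩) * HahnSeries.ofPowerSeries ℤ ℂ F).coeff i = 0 := by
  have := HahnSeries.coeff_single_mul_add (r := (1 : ℂ)) (x := HahnSeries.ofPowerSeries ℤ ℂ F)
    (a := i - k) (b := k)
  rw [sub_add_cancel] at this
  rw [this, one_mul]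
  exact (PowerSeries.coeff_coe F (i - k)).trans (if_pos (by omega))

theorem coeff_serL (c : ℕ → ℂ) (r : ℕ) : (serL c).coeff ((r : ℤ) + 1) = c r := by
  rw [serL, coeff_single_mul_ofPowerSeries, PowerSeries.coeff_mk]

theorem serL_add (c d : ℕ → ℂ) : serL (c + d) = serL c + serL d := by
  rw [serL, serL, serL, ← mul_add, ← map_add]
  congr 2

theorem serL_zero : serL 0 = 0 := by
  have : PowerSeries.mk (0 : ℕ → ℂ) = 0 := rfl
  rw [serL, this, map_zero, mul_zero]

theorem serL_mul (c d : ℕ → ℂ) : serL c * serL d = HahnSeries.single 2 1 *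
    HahnSeries.ofPowerSeries ℤ ℂ (PowerSeries.mk c * PowerSeries.mk d) := by
  have : (HahnSeries.single 2 1 : ℂ⸨X⸩) = HahnSeries.single 1 1 * HahnSeries.single 1 1 := by
    rw [HahnSeries.single_mul_single]; norm_num
  rw [serL, serL, this, map_mul]
  ring

theorem coeff_serL_mul (c d : ℕ → ℂ) (m : ℕ) : (serL c * serL d).coeff ((m : ℤ) + 2) =
    ∑ p ∈ Finset.HasAntidiagonal.antidiagonal m, c p.1 * d p.2 := by
  rw [serL_mul, coeff_single_mul_ofPowerSeries, PowerSeries.coeff_mul]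
  simp

theorem coeff_serL_mul_of_lt (c d : ℕ → ℂ) {i : ℤ} (hi : i < 2) :
    (serL c * serL d).coeff i = 0 := by
  rw [serL_mul, coeff_single_mul_ofPowerSeries_of_lt _ _ hi]

theorem coeff_ddx (f : ℂ⸨X⸩) (i : ℤ) : (ddx f).coeff (i + 2) = -((i + 1) * f.coeff (i + 1)) := by
  rw [ddx, HahnSeries.coeff_neg, add_comm i 2, add_comm 2 i, HahnSeries.coeff_single_mul_add,
    one_mul, LaurentSeries.derivative_apply, LaurentSeries.hasseDeriv_coeff]
  simp

theorem coeff_ddx_serL_of_lt (c : ℕ → ℂ) {i : ℤ} (hi : i < 2) : (ddx (serL c)).coeff i = 0 := by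
  have := coeff_ddx (serL c) (i - 2)
  rw [sub_add_cancel] at this
  rw [this, serL, coeff_single_mul_ofPowerSeries_of_lt]
  · simp
  · omega

theorem polyL_X_sub_C_mul_serL (a : ℂ) : polyL (X - C a) * serL (a ^ ·) = 1 := by
  have h1 : polyL (X - C a) * HahnSeries.single 1 1 =
      HahnSeries.ofPowerSeries ℤ ℂ (1 - PowerSeries.C a * PowerSeries.X) := by
    simp only [polyL, xL, coe_eval₂RingHom, eval₂_X, eval₂_C, sub_mul, map_sub, map_mul,
      map_one, HahnSeries.ofPowerSeries_C, HahnSeries.ofPowerSeries_X,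
      HahnSeries.single_mul_single]
    simp
  rw [serL, ← mul_assoc, h1, ← map_mul, ← map_one (HahnSeries.ofPowerSeries ℤ ℂ)]
  congr 1
  ext n
  rw [sub_mul, one_mul, map_sub, mul_assoc, PowerSeries.coeff_C_mul]
  cases n with
  | zero => simp
  | succ n => rw [PowerSeries.coeff_succ_X_mul]; simp [pow_succ']

theorem polyL_derivative_prod (s : Multiset ℂ) :
    polyL (derivative (s.map fun a => X - C a).prod) =
      serL (fun r => (s.map (· ^ r)).sum) * polyL (s.map fun a => X - C a).prod := by
  induction s using Multiset.induction_on with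
  | empty =>
    have : (fun r : ℕ => ((0 : Multiset ℂ).map (· ^ r)).sum) = 0 := funext fun _ => by simp
    rw [this, serL_zero]
    simp
  | cons a s ih =>
    have : (fun r : ℕ => ((a ::ₘ s).map (· ^ r)).sum) =
        (a ^ ·) + fun r => (s.map (· ^ r)).sum := funext fun _ => by simp
    rw [this, serL_add, Multiset.map_cons, Multiset.prod_cons, derivative_mul, map_add, map_mul,
      map_mul, ih, map_mul]
    have h := polyL_X_sub_C_mul_serL a
    simp only [derivative_sub, derivative_X, derivative_C, sub_zero, map_one]
    linear_combination -polyL (s.map fun a => X - C a).prod * h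

theorem polyL_ne_zero_of_monic {y : ℂ[X]} (hy : y.Monic) : polyL y ≠ 0 := by
  rw [(IsAlgClosed.splits y).eq_prod_roots_of_monic hy, map_multiset_prod, Multiset.map_map]
  refine Multiset.prod_ne_zero fun h => ?_
  obtain ⟨a, -, ha⟩ := Multiset.mem_map.1 h
  exact polyL_X_sub_C_ne_zero a ha

theorem polyL_derivative_div {y : ℂ[X]} (hy : y.Monic) :
    polyL (derivative y) / polyL y = serL (rootPsum y) := by
  rw [div_eq_iff (polyL_ne_zero_of_monic hy)]
  have := polyL_derivative_prod y.roots
  rwa [← (IsAlgClosed.splits y).eq_prod_roots_of_monic hy] at this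

/-- The product `∏ (x - b_s)^{n_s}`. -/
def etaPoly {k : ℕ} (n : Fin k → ℕ) (b : Fin k → ℂ) : ℂ[X] := ∏ s, (X - C (b s)) ^ n s

theorem monic_etaPoly {k : ℕ} (n : Fin k → ℕ) (b : Fin k → ℂ) : (etaPoly n b).Monic :=
  monic_prod_of_monic _ _ fun _ _ => (monic_X_sub_C _).pow _

theorem natDegree_etaPoly {k : ℕ} (n : Fin k → ℕ) (b : Fin k → ℂ) :
    (etaPoly n b).natDegree = ∑ s, n s := by
  rw [etaPoly, natDegree_prod_of_monic _ _ fun _ _ => (monic_X_sub_C _).pow _]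
  simp

theorem psi_eq_derivative {k : ℕ} (n : Fin k → ℕ) (b : Fin k → ℂ) :
    psi n b = derivative (etaPoly n b) := by
  rw [psi, etaPoly, derivative_prod_finset]
  refine Finset.sum_congr rfl fun s _ => ?_
  rw [derivative_X_sub_C_pow, mul_comm]
  simp

theorem zeta_eq_serL {k : ℕ} (n : Fin k → ℕ) (b : Fin k → ℂ) :
    zeta n b = serL (rootPsum (etaPoly n b)) := by
  have h := polyL_psi n b
  have h' : ∏ r, polyL (X - C (b r)) ^ n r = polyL (etaPoly n b) := by
    simp [etaPoly, map_prod]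
  rw [← polyL_derivative_div (monic_etaPoly n b), eq_div_iff (polyL_ne_zero_of_monic
    (monic_etaPoly n b)), ← psi_eq_derivative, h, h']

section Convolution

variable {K : Type*} [Field K] {c : ℕ → K}

theorem mem_of_convolution_mem {W : Type*} [AddCommGroup W] [Module K W] (hc : c 0 ≠ 0)
    {f : ℕ → W} {S : Submodule K W}
    (h : ∀ m, ∑ p ∈ Finset.HasAntidiagonal.antidiagonal m, c p.1 • f p.2 ∈ S) (r : ℕ) :
    f r ∈ S := by
  induction r using Nat.strong_induction_on with
  | _ r ih =>
    have hr := h r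
    have hmem : ((0, r) : ℕ × ℕ) ∈ Finset.HasAntidiagonal.antidiagonal r := by simp
    rw [← Finset.add_sum_erase _ _ hmem] at hr
    have hrest : ∑ p ∈ (Finset.HasAntidiagonal.antidiagonal r).erase (0, r),
        c p.1 • f p.2 ∈ S := by
      refine Submodule.sum_mem _ fun p hp => Submodule.smul_mem _ _ (ih _ ?_)
      obtain ⟨hne, hp⟩ := Finset.mem_erase.1 hp
      rw [Finset.HasAntidiagonal.mem_antidiagonal] at hp
      rcases Nat.eq_zero_or_pos p.1 with h0 | h0
      · exact absurd (Prod.ext h0 (by simpa [h0] using hp)) hne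
      · omega
    exact (Submodule.smul_mem_iff _ hc).1 ((Submodule.add_mem_iff_left _ hrest).1 hr)

theorem eq_of_convolution_eq (hc : c 0 ≠ 0) {W : Type*} [AddCommGroup W] [Module K W]
    {f g : ℕ → W}
    (h : ∀ m, ∑ a ∈ Finset.HasAntidiagonal.antidiagonal m, c a.1 • f a.2 =
      ∑ a ∈ Finset.HasAntidiagonal.antidiagonal m, c a.1 • g a.2) : f = g := by
  funext r
  have hr := mem_of_convolution_mem hc (f := fun r => f r - g r) (S := ⊥) (fun m => ?_) r
  · exact sub_eq_zero.1 ((Submodule.mem_bot K).1 hr)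
  · simp only [smul_sub, Finset.sum_sub_distrib, h, sub_self, Submodule.zero_mem]

end Convolution

section EigenSeries

variable (c p : ℕ → ℂ)

/-- The series `½ c'(x) - c(x) p(x) + ½ c(x)²` for `c(x) = ∑_r c_r x^{-r-1}` and
`p(x) = ∑_r p_r x^{-r-1}`. -/
def eigenSeries : ℂ⸨X⸩ :=
  HahnSeries.C (1 / 2 : ℂ) * ddx (serL c) - serL c * serL p +
    HahnSeries.C (1 / 2 : ℂ) * serL c ^ 2

/-- The coefficients of `½ c(x)² + ½ c'(x)`: the scalar by which the transfer matrix acts on the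
generator of a module where `(e_{11} + e_{22})(x)` acts by `c(x)`. -/
def transferScalar (m : ℕ) : ℂ :=
  (1 / 2) * (∑ a ∈ Finset.HasAntidiagonal.antidiagonal m, c a.1 * c a.2 - (m + 1) * c m)

theorem coeff_eigenSeries (m : ℕ) : (eigenSeries c p).coeff ((m : ℤ) + 2) =
    transferScalar c m - ∑ a ∈ Finset.HasAntidiagonal.antidiagonal m, c a.1 * p a.2 := by
  rw [eigenSeries, transferScalar, sq, HahnSeries.coeff_add, HahnSeries.coeff_sub,
    HahnSeries.C_mul_eq_smul, HahnSeries.C_mul_eq_smul, HahnSeries.coeff_smul,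
    HahnSeries.coeff_smul, coeff_serL_mul, coeff_serL_mul, coeff_ddx, coeff_serL]
  simp only [smul_eq_mul]
  push_cast
  ring

theorem coeff_eigenSeries_of_lt {i : ℤ} (hi : i < 2) : (eigenSeries c p).coeff i = 0 := by
  rw [eigenSeries, sq, HahnSeries.coeff_add, HahnSeries.coeff_sub, HahnSeries.C_mul_eq_smul,
    HahnSeries.C_mul_eq_smul, HahnSeries.coeff_smul, HahnSeries.coeff_smul,
    coeff_serL_mul_of_lt _ _ hi, coeff_serL_mul_of_lt _ _ hi, coeff_ddx_serL_of_lt _ hi]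
  simp

variable {c p} in
theorem eq_eigenSeries {ξ : ℂ⸨X⸩} (coeff_of_lt : ∀ i < 2, ξ.coeff i = 0)
    (coeff_add_two : ∀ m : ℕ, ξ.coeff ((m : ℤ) + 2) =
      transferScalar c m - ∑ a ∈ Finset.HasAntidiagonal.antidiagonal m, c a.1 * p a.2) :
    ξ = eigenSeries c p := by
  ext i
  rcases lt_or_ge i 2 with hi | hi
  · rw [coeff_of_lt i hi, coeff_eigenSeries_of_lt _ _ hi]
  · obtain ⟨m, hm⟩ := Int.eq_ofNat_of_zero_le (sub_nonneg.2 hi)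
    obtain rfl : i = (m : ℤ) + 2 := by omega
    rw [coeff_add_two, coeff_eigenSeries]

variable {c} in
theorem eigenSeries_injective (hc : c 0 ≠ 0) : Function.Injective (eigenSeries c) :=
  fun p q h => eq_of_convolution_eq hc fun m => by
    have hm := congrArg (fun f : ℂ⸨X⸩ => f.coeff ((m : ℤ) + 2)) h
    simpa only [coeff_eigenSeries, sub_right_inj, smul_eq_mul] using hm

end EigenSeries

theorem eigenvalue_eq_eigenSeries {k : ℕ} (n : Fin k → ℕ) (b : Fin k → ℂ) {y : ℂ[X]}
    (hy : y.Monic) :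
    eigenvalue n b y = eigenSeries (rootPsum (etaPoly n b)) (rootPsum y) := by
  rw [eigenvalue, eigenSeries, polyL_derivative_div hy, zeta_eq_serL]

namespace CurrentRep

section Transfer

variable {M : Type*} [AddCommGroup M] [Module ℂ M] (ρ : CurrentRep M) {c : ℕ → ℂ}

theorem sum_e00_mul_e00 (hc : ∀ r, ρ.cent r = c r • 1) (m : ℕ) :
    ∑ p ∈ Finset.HasAntidiagonal.antidiagonal m, ρ.e 0 0 p.1 * ρ.e 0 0 p.2 =
      (∑ p ∈ Finset.HasAntidiagonal.antidiagonal m, c p.1 * c p.2) • 1 -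
        (2 : ℂ) • ∑ p ∈ Finset.HasAntidiagonal.antidiagonal m, c p.1 • ρ.e 1 1 p.2 +
        ∑ p ∈ Finset.HasAntidiagonal.antidiagonal m, ρ.e 1 1 p.1 * ρ.e 1 1 p.2 := by
  have he (r : ℕ) : ρ.e 0 0 r = c r • 1 - ρ.e 1 1 r := by
    rw [← hc, cent, add_sub_cancel_right]
  have hswap := Finset.Nat.sum_antidiagonal_swap (n := m) (f := fun p => c p.1 • ρ.e 1 1 p.2)
  rw [two_smul]
  nth_rewrite 1 [← hswap]
  rw [Finset.sum_smul, ← Finset.sum_add_distrib, ← Finset.sum_sub_distrib,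
    ← Finset.sum_add_distrib]
  refine Finset.sum_congr rfl fun p _ => ?_
  rw [he, he]
  simp only [sub_mul, mul_sub, smul_mul_assoc, mul_smul_comm, one_mul, mul_one, Prod.fst_swap,
    Prod.snd_swap]
  module

theorem sum_e01_mul_e10 (hc : ∀ r, ρ.cent r = c r • 1) (m : ℕ) :
    ∑ p ∈ Finset.HasAntidiagonal.antidiagonal m, ρ.e 0 1 p.1 * ρ.e 1 0 p.2 =
      (((m : ℂ) + 1) * c m) • 1 -
        ∑ p ∈ Finset.HasAntidiagonal.antidiagonal m, ρ.e 1 0 p.1 * ρ.e 0 1 p.2 := by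
  have hterm : ∀ p ∈ Finset.HasAntidiagonal.antidiagonal m,
      ρ.e 0 1 p.1 * ρ.e 1 0 p.2 = c m • 1 - ρ.e 1 0 p.2 * ρ.e 0 1 p.1 := fun p hp => by
    rw [e01_e10, ← cent, hc, Finset.HasAntidiagonal.mem_antidiagonal.1 hp]
  have hswap :=
    Finset.Nat.sum_antidiagonal_swap (n := m) (f := fun p => ρ.e 1 0 p.1 * ρ.e 0 1 p.2)
  simp only [Prod.fst_swap, Prod.snd_swap] at hswap
  rw [Finset.sum_congr rfl hterm, Finset.sum_sub_distrib, hswap, Finset.sum_const,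
    Finset.Nat.card_antidiagonal, ← Nat.cast_smul_eq_nsmul ℂ, smul_smul, Nat.cast_succ]

theorem transfer_eq (hc : ∀ r, ρ.cent r = c r • 1) (m : ℕ) :
    ρ.transfer m = transferScalar c m • 1 +
      ∑ p ∈ Finset.HasAntidiagonal.antidiagonal m,
        (ρ.e 1 0 p.1 * ρ.e 0 1 p.2 - c p.1 • ρ.e 1 1 p.2) := by
  rw [transfer, transferScalar]
  simp only [Fin.sum_univ_two, Fin.val_zero, Fin.val_one, pow_zero, pow_one, one_smul, neg_smul,
    ρ.sum_e00_mul_e00 hc, ρ.sum_e01_mul_e10 hc, Finset.sum_sub_distrib]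
  module

end Transfer

section SingMap

variable {M : Type*} [AddCommGroup M] [Module ℂ M] (ρ : CurrentRep M) {η : ℂ[X]} (hη : η.Monic)
  (hN : η.natDegree ≠ 0)

/-- The map from the exterior algebra of `ℂ[X]/(η')` that parametrizes the singular vectors. -/
def singMap (w : M) : ExteriorAlgebra ℂ (AdjoinRoot (monicDeriv η)) →ₗ[ℂ] M :=
  ρ.fockMap hη w ∘ₗ (ExteriorAlgebra.map (derivEmb hη hN)).toLinearMap

variable {ρ} {w : M}

theorem singMap_injective (hinj : Function.Injective (ρ.fockMap hη w)) :
    Function.Injective (ρ.singMap hη hN w) :=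
  hinj.comp <| ExteriorAlgebra.map_injective_field <|
    LinearMap.ker_eq_bot.2 (derivEmb_injective hη hN)

namespace IsWeylVector

theorem range_singMap (h : ρ.IsWeylVector η w) (hgen : ρ.lowSpan w = ⊤)
    (hinj : Function.Injective (ρ.fockMap hη w)) :
    LinearMap.range (ρ.singMap hη hN w) = ρ.sing := by
  have hsing : LinearMap.ker (Fock.contract (traceForm hη)) = ρ.sing.comap (ρ.fockMap hη w) := by
    ext x
    have hx := h.fockMap_contract hgen hη 0 x
    rw [pow_zero, Module.End.one_eq_id, LinearMap.comp_id] at hx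
    rw [Submodule.mem_comap, sing, LinearMap.mem_ker, LinearMap.mem_ker, ← hx,
      map_eq_zero_iff _ hinj]
  rw [singMap, LinearMap.range_comp, Fock.range_map_eq_ker_contract (traceForm_ne_zero hη hN)
    (range_derivEmb hη hN), hsing,
    Submodule.map_comap_eq_of_surjective (h.fockMap_surjective hgen hη)]

theorem transfer_fockMap (h : ρ.IsWeylVector η w) (hgen : ρ.lowSpan w = ⊤) (m : ℕ)
    (x : ExteriorAlgebra ℂ (AdjoinRoot η)) :
    ρ.transfer m (ρ.fockMap hη w x) =
      ρ.fockMap hη w (transferScalar (rootPsum η) m • x + Fock.dΓ (gaudinOp hη m) x) := by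
  have he (r s : ℕ) : ρ.e 1 0 r (ρ.e 0 1 s (ρ.fockMap hη w x)) = ρ.fockMap hη w
      (Fock.dΓ ((traceForm hη ∘ₗ rootMul η ^ s).smulRight (AdjoinRoot.root η ^ r)) x) := by
    rw [Fock.dΓ_smulRight, ← AdjoinRoot.mk_X, ← map_pow, h.fockMap_ι_mul hgen, low_X_pow,
      ← h.fockMap_contract hgen]
  rw [ρ.transfer_eq (h.cent_eq hgen), gaudinOp]
  simp only [LinearMap.add_apply, LinearMap.smul_apply, LinearMap.sum_apply, LinearMap.sub_apply,
    Module.End.mul_apply, Module.End.one_apply, map_add, map_smul, map_sum, map_sub, he,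
    ← h.fockMap_dΓ hgen hη]

theorem transfer_singMap (h : ρ.IsWeylVector η w) (hgen : ρ.lowSpan w = ⊤) (m : ℕ)
    (x : ExteriorAlgebra ℂ (AdjoinRoot (monicDeriv η))) :
    ρ.transfer m (ρ.singMap hη hN w x) =
      ρ.singMap hη hN w (transferScalar (rootPsum η) m • x -
        ∑ a ∈ Finset.HasAntidiagonal.antidiagonal m,
          rootPsum η a.1 • Fock.dΓ (rootMul (monicDeriv η) ^ a.2) x) := by
  have hgaudin : gaudinOp hη m ∘ₗ derivEmb hη hN = derivEmb hη hN ∘ₗ singGaudinOp η m :=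
    LinearMap.ext (gaudinOp_derivEmb hη hN m)
  have hsing : Fock.dΓ (singGaudinOp η m) x = -∑ a ∈ Finset.HasAntidiagonal.antidiagonal m,
      rootPsum η a.1 • Fock.dΓ (rootMul (monicDeriv η) ^ a.2) x := by
    simp only [singGaudinOp, map_neg, map_sum, map_smul, LinearMap.neg_apply,
      LinearMap.sum_apply, LinearMap.smul_apply]
  rw [sub_eq_add_neg, ← hsing, singMap, LinearMap.comp_apply, LinearMap.comp_apply,
    AlgHom.toLinearMap_apply, AlgHom.toLinearMap_apply, h.transfer_fockMap hη hgen,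
    Fock.dΓ_map hgaudin, map_add, map_add, map_add, map_smul, map_smul, map_smul]

theorem isEigenvector_singMap_iff (h : ρ.IsWeylVector η w) (hgen : ρ.lowSpan w = ⊤)
    (hinj : Function.Injective (ρ.fockMap hη w)) {ξ : ℂ⸨X⸩}
    {x : ExteriorAlgebra ℂ (AdjoinRoot (monicDeriv η))} :
    ρ.IsEigenvector ξ (ρ.singMap hη hN w x) ↔
      ∃ p, Fock.IsJointEigenvector (rootMul (monicDeriv η)) p x ∧
        ξ = eigenSeries (rootPsum η) p := by
  have hJ := singMap_injective hη hN hinj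
  constructor
  · rintro ⟨hne, hlt, hξ⟩
    have hx0 : x ≠ 0 := fun hx => hne (by rw [hx, map_zero])
    have hconv (m : ℕ) : ∑ a ∈ Finset.HasAntidiagonal.antidiagonal m,
        rootPsum η a.1 • Fock.dΓ (rootMul (monicDeriv η) ^ a.2) x =
        (transferScalar (rootPsum η) m - ξ.coeff ((m : ℤ) + 2)) • x := by
      have hm := hξ m
      rw [h.transfer_singMap hη hN hgen, ← map_smul] at hm
      rw [sub_smul, ← hJ hm, sub_sub_cancel]
    have hspan := mem_of_convolution_mem (rootPsum_zero_ne_zero hN)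
      (f := fun r => Fock.dΓ (rootMul (monicDeriv η) ^ r) x) (S := ℂ ∙ x) fun m => by
        rw [hconv]; exact Submodule.smul_mem _ _ (Submodule.mem_span_singleton_self x)
    choose p hp using fun r => Submodule.mem_span_singleton.1 (hspan r)
    refine ⟨p, ⟨hx0, fun r => (hp r).symm⟩, eq_eigenSeries hlt fun m => ?_⟩
    have hm := hconv m
    simp only [← hp, smul_smul, ← Finset.sum_smul] at hm
    rw [smul_left_injective ℂ hx0 hm, sub_sub_cancel]
  · rintro ⟨p, hx, rfl⟩
    refine ⟨(map_ne_zero_iff _ hJ).2 hx.ne_zero, fun i => coeff_eigenSeries_of_lt _ _,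
      fun m => ?_⟩
    rw [h.transfer_singMap hη hN hgen, coeff_eigenSeries, ← map_smul]
    simp only [hx.apply, smul_smul, ← Finset.sum_smul, ← sub_smul]

end IsWeylVector

end SingMap

end CurrentRep

open CurrentRep

section Weyl

theorem U_induction {P : U → Prop} (u : U) (algebraMap : ∀ c : ℂ, P (algebraMap ℂ U c))
    (uE : ∀ i j r, P (uE i j r)) (add : ∀ u v, P u → P v → P (u + v))
    (mul : ∀ u v, P u → P v → P (u * v)) : P u := by
  obtain ⟨f, rfl⟩ : ∃ f, toU f = u := RingQuot.mkAlgHom_surjective ℂ Rel u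
  induction f using FreeAlgebra.induction with
  | grade0 c => rw [AlgHom.commutes]; exact algebraMap c
  | grade1 p => exact uE p.1 p.2.1 p.2.2
  | mul a b ha hb => rw [map_mul]; exact mul _ _ ha hb
  | add a b ha hb => rw [map_add]; exact add _ _ ha hb

/-- The generator of the Weyl module. -/
def weylVec (η : ℂ[X]) : Weyl η := weylMk η 1

variable {η : ℂ[X]}

theorem weylMk_eq_smul (u : U) : weylMk η u = u • weylVec η := by
  rw [weylVec, ← weylMk_mul, mul_one]

theorem smul_weylVec_eq_zero {u : U} (hu : IsWeylRelation η u) : u • weylVec η = 0 := by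
  rw [← weylMk_eq_smul]
  exact (Submodule.Quotient.mk_eq_zero _).2 (Submodule.subset_span hu)

theorem weylRep_e_apply (i j : Fin 2) (r : ℕ) (v : Weyl η) :
    (weylRep η).e i j r v = uE i j r • v := rfl

theorem weylRep_parity_weylVec : (weylRep η).parity (weylVec η) = weylVec η := by
  change weylParity η (weylMk η 1) = weylMk η 1
  rw [weylParity_mk, map_one]

theorem isWeylVector_weylVec (hη : η.Monic) : (weylRep η).IsWeylVector η (weylVec η) where
  e00 r := by
    have h := smul_weylVec_eq_zero (IsWeylRelation.e11 (η := η) r)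
    rw [polyL_derivative_div hη, coeff_serL, sub_smul, sub_eq_zero] at h
    rw [weylRep_e_apply, h, algebraMap_smul]
  e11 r := smul_weylVec_eq_zero (IsWeylRelation.e22 r)
  e01 r := smul_weylVec_eq_zero (IsWeylRelation.e12 r)
  low := by
    rw [low_eq_sum, LinearMap.sum_apply,
      ← smul_weylVec_eq_zero (IsWeylRelation.e21 (η := η)), Finset.sum_smul]
    refine Finset.sum_congr rfl fun i _ => ?_
    rw [LinearMap.smul_apply, weylRep_e_apply, smul_assoc]

theorem lowSpan_weylVec (hη : η.Monic) : (weylRep η).lowSpan (weylVec η) = ⊤ := by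
  have hstable (u : U) : ∀ v ∈ (weylRep η).lowSpan (weylVec η),
      u • v ∈ (weylRep η).lowSpan (weylVec η) := by
    induction u using U_induction with
    | algebraMap c => intro v hv; rw [algebraMap_smul]; exact Submodule.smul_mem _ _ hv
    | uE i j r => exact fun v hv => (isWeylVector_weylVec hη).e_mem hv i j r
    | add u u' hu hu' => intro v hv; rw [add_smul]; exact add_mem (hu v hv) (hu' v hv)
    | mul u u' hu hu' => intro v hv; rw [mul_smul]; exact hu _ (hu' v hv)
  refine eq_top_iff.2 fun v _ => ?_
  obtain ⟨u, rfl⟩ := weylMk_surjective η v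
  rw [weylMk_eq_smul]
  exact hstable u _ ((weylRep η).mem_lowSpan _)

end Weyl

section FockRep

variable {η : ℂ[X]} (hη : η.Monic)

/-- The action of `e_{ij}[r]` on the exterior algebra of `ℂ[X]/(η)`. -/
def fockE (i j : Fin 2) (r : ℕ) : Module.End ℂ (ExteriorAlgebra ℂ (AdjoinRoot η)) :=
  !![rootPsum η r • 1 - Fock.dΓ (rootMul η ^ r), Fock.contract (traceForm hη ∘ₗ rootMul η ^ r);
    LinearMap.mulLeft ℂ (ExteriorAlgebra.ι ℂ (AdjoinRoot.root η ^ r)),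
      Fock.dΓ (rootMul η ^ r)] i j

theorem contract_trace_ι_root_mul (r s : ℕ) (x : ExteriorAlgebra ℂ (AdjoinRoot η)) :
    Fock.contract (traceForm hη ∘ₗ rootMul η ^ r)
        (ExteriorAlgebra.ι ℂ (AdjoinRoot.root η ^ s) * x) =
      rootPsum η (r + s) • x - ExteriorAlgebra.ι ℂ (AdjoinRoot.root η ^ s) *
        Fock.contract (traceForm hη ∘ₗ rootMul η ^ r) x := by
  rw [Fock.contract_ι_mul, LinearMap.comp_apply, rootMul_pow_apply, ← pow_add, traceForm_root_pow]

theorem dΓ_ι_root_mul (r s : ℕ) (x : ExteriorAlgebra ℂ (AdjoinRoot η)) :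
    Fock.dΓ (rootMul η ^ r) (ExteriorAlgebra.ι ℂ (AdjoinRoot.root η ^ s) * x) =
      ExteriorAlgebra.ι ℂ (AdjoinRoot.root η ^ (r + s)) * x +
        ExteriorAlgebra.ι ℂ (AdjoinRoot.root η ^ s) * Fock.dΓ (rootMul η ^ r) x := by
  rw [Fock.dΓ_ι_mul, rootMul_pow_apply, ← pow_add]

theorem contract_trace_dΓ (r s : ℕ) (x : ExteriorAlgebra ℂ (AdjoinRoot η)) :
    Fock.contract (traceForm hη ∘ₗ rootMul η ^ r) (Fock.dΓ (rootMul η ^ s) x) =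
      Fock.dΓ (rootMul η ^ s) (Fock.contract (traceForm hη ∘ₗ rootMul η ^ r) x) +
        Fock.contract (traceForm hη ∘ₗ rootMul η ^ (r + s)) x := by
  rw [Fock.contract_dΓ, LinearMap.comp_assoc, pow_add]
  rfl

theorem fockE_bracket (i j k l : Fin 2) (r s : ℕ) :
    fockE hη i j r * fockE hη k l s -
        (-1 : ℂ) ^ (par i j * par k l) • (fockE hη k l s * fockE hη i j r) =
      (if j = k then fockE hη i l (r + s) else 0) -
        (-1 : ℂ) ^ (par i j * par k l) • (if i = l then fockE hη k j (r + s) else 0) := by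
  refine LinearMap.ext fun x => ?_
  have hlow := Fock.ι_mul_ι_mul (AdjoinRoot.root η ^ r) (AdjoinRoot.root η ^ s) x
  have hraise := Fock.contract_contract (traceForm hη ∘ₗ rootMul η ^ r)
    (traceForm hη ∘ₗ rootMul η ^ s) x
  have hcartan := LinearMap.congr_fun
    (Fock.commute_dΓ ((Commute.refl (rootMul η)).pow_pow r s)).eq x
  rw [Module.End.mul_apply, Module.End.mul_apply] at hcartan
  have hadd := add_comm s r
  fin_cases i <;> fin_cases j <;> fin_cases k <;> fin_cases l <;>
    simp only [fockE, par, Fin.zero_eta, Fin.mk_one, Fin.isValue, Matrix.of_apply,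
      Matrix.cons_val', Matrix.cons_val_zero, Matrix.cons_val_one, Matrix.cons_val_fin_one,
      reduceIte, zero_ne_one, one_ne_zero, LinearMap.sub_apply, LinearMap.smul_apply,
      LinearMap.zero_apply, Module.End.mul_apply, Module.End.one_apply, LinearMap.mulLeft_apply,
      mul_sub, mul_smul_comm, contract_trace_ι_root_mul, dΓ_ι_root_mul,
      contract_trace_dΓ, hlow, hraise, hcartan, hadd] <;>
    module

/-- The action of `U(gl(1|1)[t])` on the exterior algebra of `ℂ[X]/(η)`. -/
def fockAct : U →ₐ[ℂ] Module.End ℂ (ExteriorAlgebra ℂ (AdjoinRoot η)) :=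
  liftU (FreeAlgebra.lift ℂ fun p => fockE hη p.1 p.2.1 p.2.2) (by
    rintro _ _ ⟨i, j, k, l, r, s⟩
    let F : Free →ₐ[ℂ] Module.End ℂ (ExteriorAlgebra ℂ (AdjoinRoot η)) :=
      FreeAlgebra.lift ℂ fun p => fockE hη p.1 p.2.1 p.2.2
    have hF (i j : Fin 2) (r : ℕ) : F (gen i j r) = fockE hη i j r :=
      FreeAlgebra.lift_ι_apply _ _
    change F _ = F _
    simp only [map_sub, map_mul, map_smul, apply_ite F, map_zero, hF]
    exact fockE_bracket hη i j k l r s)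

theorem fockAct_uE (i j : Fin 2) (r : ℕ) : fockAct hη (uE i j r) = fockE hη i j r := by
  rw [fockAct, uE, liftU_toU]
  exact FreeAlgebra.lift_ι_apply _ _

theorem fockAct_uE_one_zero (r : ℕ) : fockAct hη (uE 1 0 r) =
    LinearMap.mulLeft ℂ (ExteriorAlgebra.ι ℂ (AdjoinRoot.root η ^ r)) := by
  rw [fockAct_uE]
  rfl

theorem fockAct_apply_one_of_isWeylRelation {u : U} (hu : IsWeylRelation η u) :
    fockAct hη u 1 = 0 := by
  rcases hu with r | r | r | _
  · rw [polyL_derivative_div hη, coeff_serL, map_sub, AlgHom.commutes, fockAct_uE]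
    simp [fockE, Algebra.algebraMap_eq_smul_one]
  · rw [fockAct_uE]; simp [fockE]
  · rw [fockAct_uE]; simp [fockE]
  · have hroot : ∑ i ∈ Finset.range (η.natDegree + 1), η.coeff i • AdjoinRoot.root η ^ i = 0 := by
      rw [← aeval_eq_sum_range, AdjoinRoot.aeval_eq, AdjoinRoot.mk_self]
    simp only [map_sum, map_smul, fockAct_uE_one_zero, LinearMap.sum_apply, LinearMap.smul_apply,
      LinearMap.mulLeft_apply, mul_one]
    simp only [← map_smul, ← map_sum, hroot, map_zero]

theorem fockAct_apply_one_of_mem_weylIdeal {u : U} (hu : u ∈ weylIdeal η) :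
    fockAct hη u 1 = 0 := by
  induction hu using Submodule.span_induction with
  | mem u hu => exact fockAct_apply_one_of_isWeylRelation hη hu
  | zero => simp
  | add u v _ _ hu hv => rw [map_add, LinearMap.add_apply, hu, hv, add_zero]
  | smul a u _ hu => rw [smul_eq_mul, map_mul, Module.End.mul_apply, hu, map_zero]

/-- The map `u w ↦ u 1` from the Weyl module to the exterior algebra of `ℂ[X]/(η)`. -/
def weylToFock : Weyl η →ₗ[ℂ] ExteriorAlgebra ℂ (AdjoinRoot η) :=
  (Submodule.liftQ ((weylIdeal η).restrictScalars ℂ)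
    ((LinearMap.applyₗ 1) ∘ₗ (fockAct hη).toLinearMap)
    (fun _ hu => fockAct_apply_one_of_mem_weylIdeal hη hu)).comp
    (Submodule.Quotient.restrictScalarsEquiv ℂ (weylIdeal η)).symm.toLinearMap

theorem weylToFock_mk (u : U) : weylToFock hη (weylMk η u) = fockAct hη u 1 := rfl

theorem weylToFock_low (p : ℂ[X]) (v : Weyl η) :
    weylToFock hη ((weylRep η).low p v) =
      ExteriorAlgebra.ι ℂ (AdjoinRoot.mk η p) * weylToFock hη v := by
  induction p using polynomial_linear_induction with
  | add p q hp hq => simp only [map_add, LinearMap.add_apply, hp, hq, add_mul]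
  | smul c p hp =>
    rw [map_smul, LinearMap.smul_apply, map_smul, hp, ← AdjoinRoot.smul_mk, map_smul,
      smul_mul_assoc]
  | X_pow r =>
    obtain ⟨u, rfl⟩ := weylMk_surjective η v
    rw [low_X_pow, weylRep_e_apply, ← weylMk_mul, weylToFock_mk, weylToFock_mk,
      map_mul (fockAct hη), fockAct_uE_one_zero, map_pow (AdjoinRoot.mk η), AdjoinRoot.mk_X,
      Module.End.mul_apply, LinearMap.mulLeft_apply]

theorem weylToFock_fockMap (x : ExteriorAlgebra ℂ (AdjoinRoot η)) :
    weylToFock hη ((weylRep η).fockMap hη (weylVec η) x) = x := by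
  refine LinearMap.congr_fun (f := weylToFock hη ∘ₗ (weylRep η).fockMap hη (weylVec η))
    (g := LinearMap.id) (Fock.linearMap_ext ?_ fun v x hx => ?_) x
  · rw [LinearMap.comp_apply, fockMap_one, weylVec, weylToFock_mk, map_one (fockAct hη),
      Module.End.one_apply, LinearMap.id_apply]
  · obtain ⟨p, rfl⟩ := AdjoinRoot.mk_surjective v
    simp only [LinearMap.comp_apply, LinearMap.id_apply] at hx ⊢
    rw [(isWeylVector_weylVec hη).fockMap_ι_mul (lowSpan_weylVec hη), weylToFock_low, hx]

/-- The Weyl module is a copy of the exterior algebra of `ℂ[X]/(η)`. -/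
def weylEquiv : ExteriorAlgebra ℂ (AdjoinRoot η) ≃ₗ[ℂ] Weyl η :=
  LinearEquiv.ofBijective ((weylRep η).fockMap hη (weylVec η))
    ⟨Function.LeftInverse.injective (weylToFock_fockMap hη),
      (isWeylVector_weylVec hη).fockMap_surjective (lowSpan_weylVec hη) hη⟩

/-- The basis of the exterior algebra of `ℂ[X]/(η)` that consists of the products of powers of
`X`. -/
def fockBasis :
    Module.Basis (Finset (Fin η.natDegree)) ℂ (ExteriorAlgebra ℂ (AdjoinRoot η)) :=
  (AdjoinRoot.powerBasis' hη).basis.ExteriorAlgebra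

end FockRep

namespace CurrentRep

variable {k : ℕ} {M : Fin k → Type*} [∀ s, AddCommGroup (M s)] [∀ s, Module ℂ (M s)]
  (ρ : ∀ s, CurrentRep (M s))

theorem slot_add (p : ℕ) (s : Fin k) (X Y : Module.End ℂ (M s)) :
    slot ρ p s (X + Y) = slot ρ p s X + slot ρ p s Y :=
  PiTensorProduct.map_update_add _ _ _ _

variable {ρ} in
theorem slot_tprod_of_even (p : ℕ) (s : Fin k) (X : Module.End ℂ (M s)) {m : ∀ q, M q}
    (hm : ∀ q < s, (ρ q).parity (m q) = m q) :
    slot ρ p s X (PiTensorProduct.tprod ℂ m) =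
      PiTensorProduct.tprod ℂ (Function.update m s (X (m s))) := by
  rw [slot, PiTensorProduct.map_tprod]
  congr 1
  funext q
  rcases eq_or_ne q s with rfl | h
  · simp only [Function.update_self]
  · rw [Function.update_of_ne h, Function.update_of_ne h]
    split_ifs with hq
    · rw [Module.End.pow_apply, Function.iterate_fixed (hm q hq)]
    · rfl

theorem tensor_low (p : ℂ[X]) : (tensor ρ).low p = ∑ s, slot ρ 1 s ((ρ s).low p) := by
  induction p using polynomial_linear_induction with
  | add p q hp hq => simp only [map_add, hp, hq, slot_add, Finset.sum_add_distrib]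
  | smul c p hp => simp only [map_smul, hp, slot_smul, Finset.smul_sum]
  | X_pow r => simp only [low_X_pow]; rfl

end CurrentRep

section Tensor

variable {k : ℕ} (n : Fin k → ℕ) (b : Fin k → ℂ)

theorem monic_X_sub_C_pow (a : ℂ) (m : ℕ) : ((X - C a) ^ m).Monic := (monic_X_sub_C a).pow m

/-- The tensor product of the generators of the Weyl modules. -/
def tensorVec : ⨂[ℂ] s, Weyl ((X - C (b s)) ^ n s) :=
  PiTensorProduct.tprod ℂ fun _ => weylVec _

theorem sum_slot_tensorVec (p : ℕ) {A : ∀ s, Module.End ℂ (Weyl ((X - C (b s)) ^ n s))}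
    {c : Fin k → ℂ} (hA : ∀ s, A s (weylVec _) = c s • weylVec _) :
    (∑ s, slot (fun s => weylPt (n s) (b s)) p s (A s)) (tensorVec n b) =
      (∑ s, c s) • tensorVec n b := by
  rw [LinearMap.sum_apply, Finset.sum_smul]
  refine Finset.sum_congr rfl fun s _ => ?_
  rw [tensorVec, slot_tprod_of_even (ρ := fun s => weylPt (n s) (b s)) _ _ _
    fun _ _ => weylRep_parity_weylVec, hA, MultilinearMap.map_update_smul, Function.update_eq_self]

theorem sum_slot_tensorVec_eq_zero (p : ℕ)
    {A : ∀ s, Module.End ℂ (Weyl ((X - C (b s)) ^ n s))} (hA : ∀ s, A s (weylVec _) = 0) :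
    (∑ s, slot (fun s => weylPt (n s) (b s)) p s (A s)) (tensorVec n b) = 0 := by
  rw [sum_slot_tensorVec n b p (c := fun _ => 0) fun s => by rw [hA, zero_smul],
    Finset.sum_const_zero, zero_smul]

theorem rootPsum_etaPoly (r : ℕ) :
    rootPsum (etaPoly n b) r = ∑ s, rootPsum ((X - C (b s)) ^ n s) r := by
  rw [rootPsum, etaPoly, roots_prod _ _ (monic_etaPoly n b).ne_zero, Multiset.map_bind,
    Multiset.sum_bind]
  rfl

theorem isWeylVector_tensorVec : (weylTensor n b).IsWeylVector (etaPoly n b) (tensorVec n b) where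
  e00 r := by
    rw [rootPsum_etaPoly]
    exact sum_slot_tensorVec n b _ fun s => (isWeylVector_weylVec (monic_X_sub_C_pow _ _)).e00 r
  e11 r := sum_slot_tensorVec_eq_zero n b _ fun s =>
    (isWeylVector_weylVec (monic_X_sub_C_pow _ _)).e11 r
  e01 r := sum_slot_tensorVec_eq_zero n b _ fun s =>
    (isWeylVector_weylVec (monic_X_sub_C_pow _ _)).e01 r
  low := by
    rw [weylTensor, tensor_low]
    exact sum_slot_tensorVec_eq_zero n b _ fun s =>
      (isWeylVector_weylVec (monic_X_sub_C_pow _ _)).low_apply_eq_zero_of_dvd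
        (Finset.dvd_prod_of_mem _ (Finset.mem_univ s))

variable {b}

/-- By the Chinese remainder theorem there is `q` with `q ≡ p` modulo `(X - b_s) ^ n_s` and
`q ≡ 0` modulo the other factors. -/
theorem exists_low_eq_slot (hb : Function.Injective b) (s : Fin k) (p : ℂ[X]) :
    ∃ q, (weylTensor n b).low q =
      slot (fun s => weylPt (n s) (b s)) 1 s ((weylPt (n s) (b s)).low p) := by
  have hzero (t : Fin k) (q : ℂ[X]) (hq : (X - C (b t)) ^ n t ∣ q) :
      (weylPt (n t) (b t)).low q = 0 :=
    (isWeylVector_weylVec (monic_X_sub_C_pow _ _)).low_eq_zero_of_dvd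
      (lowSpan_weylVec (monic_X_sub_C_pow _ _)) hq
  obtain ⟨u, v, huv⟩ : IsCoprime ((X - C (b s)) ^ n s)
      (∏ t ∈ Finset.univ.erase s, (X - C (b t)) ^ n t) :=
    IsCoprime.prod_right fun t ht =>
      (pairwise_coprime_X_sub_C hb (Finset.ne_of_mem_erase ht).symm).pow
  refine ⟨p * (v * ∏ t ∈ Finset.univ.erase s, (X - C (b t)) ^ n t), ?_⟩
  rw [weylTensor, tensor_low, Finset.sum_eq_single_of_mem s (Finset.mem_univ s)]
  · congr 1
    rw [← sub_eq_zero, ← map_sub]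
    exact hzero s _ ⟨-(p * u), by linear_combination p * huv⟩
  · intro t _ hts
    rw [hzero t, slot_zero]
    exact ((Finset.dvd_prod_of_mem _ (Finset.mem_erase.2 ⟨hts, Finset.mem_univ t⟩)).mul_left
      _).mul_left _

theorem tprod_mem_lowSpan_of_update (hb : Function.Injective b) (s : Fin k)
    {m : ∀ s, Weyl ((X - C (b s)) ^ n s)} (hm : ∀ t < s, m t = weylVec _)
    (hs : PiTensorProduct.tprod ℂ (Function.update m s (weylVec _))
      ∈ (weylTensor n b).lowSpan (tensorVec n b)) :
    PiTensorProduct.tprod ℂ m ∈ (weylTensor n b).lowSpan (tensorVec n b) := by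
  let N : Submodule ℂ (Weyl ((X - C (b s)) ^ n s)) :=
    ((weylTensor n b).lowSpan (tensorVec n b)).comap ((PiTensorProduct.tprod ℂ).toLinearMap m s)
  have hstable (p : ℂ[X]) (v : Weyl ((X - C (b s)) ^ n s)) (hv : v ∈ N) :
      (weylPt (n s) (b s)).low p v ∈ N := by
    obtain ⟨q, hq⟩ := exists_low_eq_slot n hb s p
    have hmem := (weylTensor n b).low_mem_lowSpan hv q
    rwa [hq, MultilinearMap.toLinearMap_apply, slot_tprod_of_even, Function.update_self,
      Function.update_idem] at hmem
    intro t ht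
    rw [Function.update_of_ne ht.ne, hm t ht]
    exact weylRep_parity_weylVec
  have htop : N = ⊤ := top_le_iff.1 <|
    lowSpan_weylVec (monic_X_sub_C_pow _ _) ▸ lowSpan_le _ (N := N) hs hstable
  have hmem : m s ∈ N := htop ▸ Submodule.mem_top
  rwa [Submodule.mem_comap, MultilinearMap.toLinearMap_apply, Function.update_eq_self] at hmem

theorem tprod_mem_lowSpan (hb : Function.Injective b) {j : ℕ} (hj : j ≤ k)
    {m : ∀ s, Weyl ((X - C (b s)) ^ n s)} (hm : ∀ s : Fin k, s.val < j → m s = weylVec _) :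
    PiTensorProduct.tprod ℂ m ∈ (weylTensor n b).lowSpan (tensorVec n b) := by
  induction hj using Nat.decreasingInduction generalizing m with
  | self =>
    obtain rfl : m = fun _ => weylVec _ := funext fun s => hm s s.isLt
    exact (weylTensor n b).mem_lowSpan _
  | of_succ j hj ih =>
    refine tprod_mem_lowSpan_of_update n hb ⟨j, hj⟩ hm (ih fun s hs => ?_)
    rcases eq_or_ne s ⟨j, hj⟩ with rfl | hne
    · rw [Function.update_self]
    · rw [Function.update_of_ne hne]
      exact hm s (lt_of_le_of_ne (Nat.le_of_lt_succ hs) (Fin.val_ne_of_ne hne))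

theorem lowSpan_tensorVec (hb : Function.Injective b) :
    (weylTensor n b).lowSpan (tensorVec n b) = ⊤ := by
  rw [eq_top_iff, ← PiTensorProduct.span_tprod_eq_top, Submodule.span_le]
  rintro _ ⟨m, rfl⟩
  exact tprod_mem_lowSpan n hb k.zero_le fun s hs => absurd hs s.val.not_lt_zero

theorem fockMap_tensorVec_injective (hb : Function.Injective b) :
    Function.Injective ((weylTensor n b).fockMap (monic_etaPoly n b) (tensorVec n b)) := by
  let fock := fockBasis (monic_etaPoly n b)
  let weyl := Basis.piTensorProduct fun s =>
    (fockBasis (monic_X_sub_C_pow (b s) (n s))).map (weylEquiv (monic_X_sub_C_pow (b s) (n s)))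
  have := fock.finiteDimensional_of_finite
  have := weyl.finiteDimensional_of_finite
  have hrank : Module.finrank ℂ (ExteriorAlgebra ℂ (AdjoinRoot (etaPoly n b))) =
      Module.finrank ℂ (⨂[ℂ] s, Weyl ((X - C (b s)) ^ n s)) := by
    rw [Module.finrank_eq_card_basis fock, Module.finrank_eq_card_basis weyl, Fintype.card_pi]
    simp [natDegree_etaPoly, Finset.prod_pow_eq_pow_sum]
  exact (LinearMap.injective_iff_surjective_of_finrank_eq_finrank hrank).2 <|
    (isWeylVector_tensorVec n b).fockMap_surjective (lowSpan_tensorVec n hb) (monic_etaPoly n b)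

end Tensor

namespace CurrentRep

section Eigenlines

variable {M : Type*} [AddCommGroup M] [Module ℂ M] {ρ : CurrentRep M} {K : Submodule ℂ M}

theorem IsEigenvector.smul {ξ : ℂ⸨X⸩} {v : M} (h : ρ.IsEigenvector ξ v) {a : ℂ} (ha : a ≠ 0) :
    ρ.IsEigenvector ξ (a • v) :=
  ⟨smul_ne_zero ha h.1, h.2.1, fun m => by rw [map_smul, h.2.2, smul_comm]⟩

theorem IsEigenvector.eigenvalue_unique {ξ ξ' : ℂ⸨X⸩} {v : M} (h : ρ.IsEigenvector ξ v)
    (h' : ρ.IsEigenvector ξ' v) : ξ = ξ' := by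
  ext i
  rcases lt_or_ge i 2 with hi | hi
  · rw [h.2.1 i hi, h'.2.1 i hi]
  · obtain ⟨m, hm⟩ := Int.eq_ofNat_of_zero_le (sub_nonneg.2 hi)
    obtain rfl : i = (m : ℤ) + 2 := by omega
    exact smul_left_injective ℂ h.1 ((h.2.2 m).symm.trans (h'.2.2 m))

theorem SimpleSpectrum.exists_equiv_eigenlines (hK : ρ.SimpleSpectrum K) {D : Type*}
    {E : D → ℂ⸨X⸩} (hE : Function.Injective E)
    (hspec : ∀ ξ, (∃ v ∈ K, ρ.IsEigenvector ξ v) ↔ ξ ∈ Set.range E) :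
    ∃ Φ : D ≃ ρ.eigenlines K, ∀ d, ρ.IsEigenvector (E d) (Φ d).1.rep := by
  choose v hvK hv using fun d => (hspec (E d)).2 ⟨d, rfl⟩
  choose a ha using fun d => Projectivization.exists_smul_eq_mk_rep ℂ (v d) (hv d).1
  have hrep (d : D) : ρ.IsEigenvector (E d) (Projectivization.mk ℂ (v d) (hv d).1).rep :=
    ha d ▸ (hv d).smul (a d).ne_zero
  let Φ (d : D) : ρ.eigenlines K :=
    ⟨Projectivization.mk ℂ (v d) (hv d).1, ha d ▸ K.smul_mem (a d : ℂ) (hvK d), E d, hrep d⟩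
  refine ⟨Equiv.ofBijective Φ ⟨fun d d' hd => hE ?_, fun ⟨ℓ, hℓ, ξ, hξ⟩ => ?_⟩, hrep⟩
  · have hd' : ρ.IsEigenvector (E d') (Φ d).1.rep := hd ▸ hrep d'
    exact (hrep d).eigenvalue_unique hd'
  · obtain ⟨d, rfl⟩ := (hspec ξ).1 ⟨ℓ.rep, hℓ, hξ⟩
    obtain ⟨c, -, hc⟩ : ∃ c : ℂ, c ≠ 0 ∧ v d = c • ℓ.rep :=
      not_not.1 fun h => hK _ (hvK d) _ hℓ _ _ (hv d) hξ h rfl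
    refine ⟨d, Subtype.ext ((?_ : Projectivization.mk ℂ _ _ = _).trans ℓ.mk_rep)⟩
    exact (Projectivization.mk_eq_mk_iff' ℂ _ _ _ _).2 ⟨c, hc.symm⟩

end Eigenlines

namespace IsWeylVector

variable {M : Type*} [AddCommGroup M] [Module ℂ M] {ρ : CurrentRep M} {η : ℂ[X]} {w : M}

theorem simpleSpectrum_sing (h : ρ.IsWeylVector η w) (hgen : ρ.lowSpan w = ⊤) (hη : η.Monic)
    (hN : η.natDegree ≠ 0) (hinj : Function.Injective (ρ.fockMap hη w)) :
    ρ.SimpleSpectrum ρ.sing := by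
  intro v₁ hv₁ v₂ hv₂ ξ₁ ξ₂ hξ₁ hξ₂ hne
  rintro rfl
  rw [← h.range_singMap hη hN hgen hinj] at hv₁ hv₂
  obtain ⟨x₁, rfl⟩ := hv₁
  obtain ⟨x₂, rfl⟩ := hv₂
  obtain ⟨p₁, hx₁, hp₁⟩ := (h.isEigenvector_singMap_iff hη hN hgen hinj).1 hξ₁
  obtain ⟨p₂, hx₂, hp₂⟩ := (h.isEigenvector_singMap_iff hη hN hgen hinj).1 hξ₂
  obtain rfl := eigenSeries_injective (rootPsum_zero_ne_zero hN) (hp₁.symm.trans hp₂)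
  obtain ⟨c, rfl⟩ := hx₂.exists_eq_smul (monic_monicDeriv hη hN).ne_zero hx₁
  exact hne ⟨c, left_ne_zero_of_smul hx₁.ne_zero, map_smul _ _ _⟩

theorem exists_isEigenvector_mem_sing_iff (h : ρ.IsWeylVector η w) (hgen : ρ.lowSpan w = ⊤)
    (hη : η.Monic) (hN : η.natDegree ≠ 0) (hinj : Function.Injective (ρ.fockMap hη w))
    (ξ : ℂ⸨X⸩) : (∃ v ∈ ρ.sing, ρ.IsEigenvector ξ v) ↔
      ∃ y : ℂ[X], (y.Monic ∧ y ∣ derivative η) ∧ eigenSeries (rootPsum η) (rootPsum y) = ξ := by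
  have hχ := (monic_monicDeriv hη hN).ne_zero
  rw [← h.range_singMap hη hN hgen hinj]
  constructor
  · rintro ⟨_, ⟨x, rfl⟩, hξ⟩
    obtain ⟨p, hx, rfl⟩ := (h.isEigenvector_singMap_iff hη hN hgen hinj).1 hξ
    obtain ⟨y, hy, hdvd, rfl, -⟩ := hx.exists_dvd_eq_rootPsum hχ
    exact ⟨y, ⟨hy, (dvd_monicDeriv_iff hN).1 hdvd⟩, rfl⟩
  · rintro ⟨y, ⟨hy, hdvd⟩, rfl⟩
    obtain ⟨x, hx⟩ := Fock.exists_isJointEigenvector hχ hy ((dvd_monicDeriv_iff hN).2 hdvd)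
    exact ⟨_, ⟨x, rfl⟩, (h.isEigenvector_singMap_iff hη hN hgen hinj).2 ⟨_, hx, rfl⟩⟩

theorem exists_equiv_eigenlines_sing (h : ρ.IsWeylVector η w) (hgen : ρ.lowSpan w = ⊤)
    (hη : η.Monic) (hN : η.natDegree ≠ 0) (hinj : Function.Injective (ρ.fockMap hη w)) :
    ∃ Φ : {y : ℂ[X] // y.Monic ∧ y ∣ derivative η} ≃ ρ.eigenlines ρ.sing,
      ∀ y, ρ.IsEigenvector (eigenSeries (rootPsum η) (rootPsum y.1)) (Φ y).1.rep := by
  refine (h.simpleSpectrum_sing hgen hη hN hinj).exists_equiv_eigenlines (fun y z hyz => ?_)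
    fun ξ => ?_
  · exact Subtype.ext <| eq_of_rootPsum_eq y.2.1 (IsAlgClosed.splits _) z.2.1
      (IsAlgClosed.splits _) (eigenSeries_injective (rootPsum_zero_ne_zero hN) hyz)
  · rw [h.exists_isEigenvector_mem_sing_iff hgen hη hN hinj, Set.mem_range, Subtype.exists]
    simp only [exists_prop]

end IsWeylVector

end CurrentRep

end GL11

end

theorem theorem5p2 {k : ℕ} (n : Fin k → ℕ) (b : Fin k → ℂ)
    (hb : Function.Injective b) (hn : 0 < ∑ s, n s) :
    (GL11.weylTensor n b).SimpleSpectrum (GL11.weylTensor n b).sing ∧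
    ∃ Φ : {y : ℂ[X] // y.Monic ∧ y ∣ GL11.psi n b} ≃
        (GL11.weylTensor n b).eigenlines (GL11.weylTensor n b).sing,
      ∀ y, (GL11.weylTensor n b).IsEigenvector (GL11.eigenvalue n b y.1) (Φ y).1.rep := by
  have hη := GL11.monic_etaPoly n b
  have hN : (GL11.etaPoly n b).natDegree ≠ 0 := GL11.natDegree_etaPoly n b ▸ hn.ne'
  have hw := GL11.isWeylVector_tensorVec n b
  have hgen := GL11.lowSpan_tensorVec n hb
  have hinj := GL11.fockMap_tensorVec_injective n hb
  refine ⟨hw.simpleSpectrum_sing hgen hη hN hinj, ?_⟩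
  obtain ⟨Φ, hΦ⟩ := hw.exists_equiv_eigenlines_sing hgen hη hN hinj
  rw [GL11.psi_eq_derivative]
  exact ⟨Φ, fun y => GL11.eigenvalue_eq_eigenSeries n b y.2.1 ▸ hΦ y⟩
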